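/- Let $\Omega\subset\mathbb{C}^2$ be a Hartogs domain with smooth boundary, i.e. a nonempty connected open set with $(e^{i\theta}z,w)\in\Omega$ whenever $(z,w)\in\Omega$ and $\theta\in\mathbb{R}$, such that near each boundary point $\Omega$ is the set where a $C^\infty$ real function with non-vanishing differential is negative. Let $\tilde\delta$ be the signed distance function of $\Omega$: $\tilde\delta(p)$ is minus the Euclidean distance from $p$ to the boundary $b\Omega$ if $p\in\Omega$, and plus that distance if $p\notin\Omega$. Suppose that for some $w_0\in\mathbb{C}$, $B>A>0$ and $C>0$ the annulus $$M=\{(z,w_0):\ A\le |z|^2\le B\}$$ is contained in $b\Omega$, and that $$\left|\frac{\partial^2\tilde\delta}{\partial w\,\partial\bar z}(z,w_0)\right|>\frac{C}{|z|}\qquad\text{for all }(z,w_0)\in M.$$ Assume that there exist an open neighborhood $U$ of $\overline\Omega$, a strictly positive $C^\infty$ function $h$ on $U$, and a number $\tau>1$ such that $\sigma=h\,\tilde\delta^{\,\tau}$ is plurisubharmonic on $U\setminus\overline\Omega$. Then $$C<\frac{\pi}{2\log\frac{B}{A}}\qquad\text{and}\qquad \tau>\frac{\pi}{\pi-2C\log\frac{B}{A}}.$$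 -/

import Mathlib

open scoped ContDiff

noncomputable section

/-- Complex Euclidean space `ℂ²`, with the Euclidean norm; its points are written `!₂[z, w]`. -/
abbrev C2 : Type := EuclideanSpace ℂ (Fin 2)

/-- A Hartogs domain: a nonempty connected open set that is invariant under the rotations
`(z, w) ↦ (e^{iθ} z, w)`. -/
structure IsHartogsDomain (Ω : Set C2) : Prop where
  isOpen : IsOpen Ω
  isConnected : IsConnected Ω
  rotation : ∀ (θ : ℝ) (z w : ℂ),
    !₂[z, w] ∈ Ω → !₂[Complex.exp (θ * Complex.I) * z, w] ∈ Ω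

/-- `Ω` has smooth boundary: near each boundary point it is the sublevel set of a smooth real
function whose differential does not vanish at that point. -/
def HasSmoothBoundary (Ω : Set C2) : Prop :=
  ∀ p ∈ frontier Ω, ∃ (V : Set C2) (r : C2 → ℝ), IsOpen V ∧ p ∈ V ∧
    ContDiffOn ℝ ∞ r V ∧ (∀ x ∈ V, x ∈ Ω ↔ r x < 0) ∧ fderiv ℝ r p ≠ 0

open scoped Classical in
/-- The signed distance to the boundary of `Ω`: negative in `Ω`, nonnegative outside. -/
def signedBoundaryDist (Ω : Set C2) (p : C2) : ℝ :=
  if p ∈ Ω then -Metric.infDist p (frontier Ω) else Metric.infDist p (frontier Ω)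

/-- `∂f/∂z_j = (1/2) (∂f/∂x_j - i ∂f/∂y_j)`, where `z_j = x_j + i y_j`. -/
def dZ (j : Fin 2) (f : C2 → ℂ) (p : C2) : ℂ :=
  (1 / 2) * (fderiv ℝ f p (EuclideanSpace.single j 1)
    - Complex.I * fderiv ℝ f p (EuclideanSpace.single j Complex.I))

/-- `∂f/∂z̄_j = (1/2) (∂f/∂x_j + i ∂f/∂y_j)`, where `z_j = x_j + i y_j`. -/
def dZbar (j : Fin 2) (f : C2 → ℂ) (p : C2) : ℂ :=
  (1 / 2) * (fderiv ℝ f p (EuclideanSpace.single j 1)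
    + Complex.I * fderiv ℝ f p (EuclideanSpace.single j Complex.I))

/-- A (finite-valued) plurisubharmonic function on an open set `D`: upper semicontinuous, with
`φ p` at most the mean of `φ` over the boundary circle of every closed complex disc
`{p + ζ v : |ζ| ≤ 1}` contained in `D`. -/
def PlurisubharmonicOn (φ : C2 → ℝ) (D : Set C2) : Prop :=
  UpperSemicontinuousOn φ D ∧
    ∀ p v : C2, (∀ ζ : ℂ, ‖ζ‖ ≤ 1 → p + ζ • v ∈ D) →
      CircleIntegrable (fun ζ : ℂ => φ (p + ζ • v)) 0 1 ∧
        φ p ≤ Real.circleAverage (fun ζ : ℂ => φ (p + ζ • v)) 0 1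

end

open Filter Topology

/-! ### The signed distance function -/

/-! Write δ for the signed distance. Along the annulus the slice `w = w₀` lies in the boundary, so
dδ sees only the `w`-component: dδ(a, ζ) = Re(N(z) ζ) with |N(z)| = 1. Rotation invariance makes N a
function of |z|, hence N = e^{iψ(t)} with t = log|z|. The mixed derivative measures how fast N
turns: |∂²δ/∂w∂z̄| = |ψ'(t)| / (4|z|) (`norm_dZ_dZbar`). The curvature hypothesis therefore says
|ψ'| > 4C, and over an interval of length log(B/A)/2 the phase turns by more than 2C log(B/A).

Plurisubharmonicity bounds this turning from above. Dividing h δ^τ at (z, w₀ + εζ) by ε^τ and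
letting ε → 0 gives h(z, w₀) (Re(N(z) ζ))^τ, which inherits the sub-mean value inequality on complex
lines in {Re(Nζ) > 0} (`submean_blowup`). Suppose ψ varies by more than π(τ-1)/τ on [t₁, t₂].
Rescale ψ - ψ(t₁) by κ to run from 0 to π; then |κ| < τ/(τ-1). The function h sin(κ(ψ -
ψ(t₁)))^(τ-1) vanishes on the two bounding circles, so its maximum λ is attained at an interior z.
There λ sin(…)^(1-τ) touches h from above, so sin(…)^(1-τ) (Re(Nζ))^τ inherits the sub-mean value
inequality at z. An explicit choice of complex line makes its Laplacian negative
(`exists_not_submean_comparison`), a contradiction. Hence the variation is at most π(τ-1)/τ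
(`phase_variation_le`), so 2C log(B/A) < π(τ-1)/τ, which contains both conclusions.

Smoothness of δ is never established. It is differentiable at boundary points by comparison with a
defining function r, and second-order information is read off the Hessian of r. -/

theorem signedBoundaryDist_of_mem {Ω : Set C2} {p : C2} (hp : p ∈ Ω) :
    signedBoundaryDist Ω p = -Metric.infDist p (frontier Ω) := by
  simp [signedBoundaryDist, hp]

theorem signedBoundaryDist_of_notMem {Ω : Set C2} {p : C2} (hp : p ∉ Ω) :
    signedBoundaryDist Ω p = Metric.infDist p (frontier Ω) := by
  simp [signedBoundaryDist, hp]

theorem signedBoundaryDist_nonneg {Ω : Set C2} {p : C2} (hp : p ∉ Ω) :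
    0 ≤ signedBoundaryDist Ω p := by
  rw [signedBoundaryDist_of_notMem hp]; exact Metric.infDist_nonneg

theorem abs_signedBoundaryDist (Ω : Set C2) (p : C2) :
    |signedBoundaryDist Ω p| = Metric.infDist p (frontier Ω) := by
  by_cases hp : p ∈ Ω
  · rw [signedBoundaryDist_of_mem hp, abs_neg, abs_of_nonneg Metric.infDist_nonneg]
  · rw [signedBoundaryDist_of_notMem hp, abs_of_nonneg Metric.infDist_nonneg]

theorem signedBoundaryDist_frontier {Ω : Set C2} {p : C2} (hp : p ∈ frontier Ω) :
    signedBoundaryDist Ω p = 0 := by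
  rw [← abs_eq_zero, abs_signedBoundaryDist]
  exact Metric.infDist_zero_of_mem hp

theorem IsPreconnected.exists_mem_frontier {X : Type*} [TopologicalSpace X] {S Ω : Set X}
    (hS : IsPreconnected S) {p q : X} (hpS : p ∈ S) (hqS : q ∈ S) (hp : p ∈ Ω) (hq : q ∉ Ω) :
    ∃ x ∈ S, x ∈ frontier Ω := by
  by_contra! hno
  have hint : ∀ x ∈ S, x ∈ closure Ω → x ∈ interior Ω := fun x hx hc => by
    by_contra hi
    exact hno x hx ⟨hc, hi⟩
  obtain ⟨x, -, h1, h2⟩ := hS (interior Ω) (closure Ω)ᶜ isOpen_interior isClosed_closure.isOpen_compl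
    (fun x hx => by
      by_cases hc : x ∈ closure Ω
      · exact Or.inl (hint x hx hc)
      · exact Or.inr hc)
    ⟨p, hpS, hint p hpS (subset_closure hp)⟩
    ⟨q, hqS, fun hc => hq (interior_subset (hint q hqS hc))⟩
  exact h2 (subset_closure (interior_subset h1))

/-- The segment from `p` to `q` crosses the boundary. This keeps the signed distance 1-Lipschitz
where its sign changes. -/
theorem infDist_add_infDist_le {Ω : Set C2} {p q : C2} (hp : p ∈ Ω) (hq : q ∉ Ω) :
    Metric.infDist p (frontier Ω) + Metric.infDist q (frontier Ω) ≤ dist p q := by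
  obtain ⟨x, hx, hxf⟩ := (convex_segment p q).isPreconnected.exists_mem_frontier
    (left_mem_segment ℝ p q) (right_mem_segment ℝ p q) hp hq
  rw [← dist_add_dist_of_mem_segment hx, dist_comm x q]
  exact add_le_add (Metric.infDist_le_dist_of_mem hxf) (Metric.infDist_le_dist_of_mem hxf)

theorem signedBoundaryDist_sub_le (Ω : Set C2) (p q : C2) :
    signedBoundaryDist Ω p - signedBoundaryDist Ω q ≤ dist p q := by
  have h1 := Metric.infDist_le_infDist_add_dist (s := frontier Ω) (x := p) (y := q)
  have h2 := Metric.infDist_le_infDist_add_dist (s := frontier Ω) (x := q) (y := p)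
  have h3 := Metric.infDist_nonneg (s := frontier Ω) (x := p)
  have h4 := Metric.infDist_nonneg (s := frontier Ω) (x := q)
  have h5 : 0 ≤ dist p q := dist_nonneg
  rw [dist_comm q p] at h2
  by_cases hp : p ∈ Ω <;> by_cases hq : q ∈ Ω
  · rw [signedBoundaryDist_of_mem hp, signedBoundaryDist_of_mem hq]; linarith
  · rw [signedBoundaryDist_of_mem hp, signedBoundaryDist_of_notMem hq]; linarith
  · rw [signedBoundaryDist_of_notMem hp, signedBoundaryDist_of_mem hq]
    have := infDist_add_infDist_le hq hp
    rw [dist_comm] at this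
    linarith
  · rw [signedBoundaryDist_of_notMem hp, signedBoundaryDist_of_notMem hq]; linarith

theorem lipschitzWith_signedBoundaryDist (Ω : Set C2) :
    LipschitzWith 1 (signedBoundaryDist Ω) := by
  refine LipschitzWith.of_le_add fun p q => ?_
  have := signedBoundaryDist_sub_le Ω p q
  linarith

theorem abs_signedBoundaryDist_le {Ω : Set C2} {p : C2} (hp : p ∈ frontier Ω) (q : C2) :
    |signedBoundaryDist Ω q| ≤ ‖q - p‖ := by
  rw [abs_signedBoundaryDist, ← dist_eq_norm]
  exact Metric.infDist_le_dist_of_mem hp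

theorem exists_frontier_norm_eq {Ω : Set C2} (hne : (frontier Ω).Nonempty) (q : C2) :
    ∃ y ∈ frontier Ω, ‖q - y‖ = |signedBoundaryDist Ω q| := by
  obtain ⟨y, hy, h⟩ := isClosed_frontier.exists_infDist_eq_dist hne q
  exact ⟨y, hy, by rw [abs_signedBoundaryDist, h, dist_eq_norm]⟩

theorem norm_fderiv_signedBoundaryDist_le (Ω : Set C2) (q : C2) :
    ‖fderiv ℝ (signedBoundaryDist Ω) q‖ ≤ 1 := by
  simpa using norm_fderiv_le_of_lipschitz ℝ (lipschitzWith_signedBoundaryDist Ω) (x₀ := q)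

/-! ### Functionals on a Euclidean space -/

theorem exists_unit_apply_eq_norm {L : C2 →L[ℝ] ℝ} (hL : L ≠ 0) : ∃ e : C2, ‖e‖ = 1 ∧ L e = ‖L‖ := by
  set v := (InnerProductSpace.toDual ℝ C2).symm L
  have hv : ‖v‖ = ‖L‖ := by simp [v]
  have hv0 : ‖v‖ ≠ 0 := by rw [hv]; exact norm_ne_zero_iff.2 hL
  refine ⟨(‖v‖)⁻¹ • v, by rw [norm_smul, norm_inv, norm_norm, inv_mul_cancel₀ hv0], ?_⟩
  have h : L v = ‖v‖ ^ 2 := by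
    rw [← InnerProductSpace.toDual_symm_apply (𝕜 := ℝ) (y := L), real_inner_self_eq_norm_sq]
  rw [map_smul, h, smul_eq_mul, ← hv]
  field_simp

/-- Equality case of Cauchy–Schwarz: ‖v - e‖² = ‖v‖² - 2 + 1 ≤ 0. -/
theorem toDual_symm_eq_of_apply_eq_one {L : C2 →L[ℝ] ℝ} (hL : ‖L‖ ≤ 1) {e : C2} (he : ‖e‖ = 1)
    (h : L e = 1) : (InnerProductSpace.toDual ℝ C2).symm L = e := by
  set v := (InnerProductSpace.toDual ℝ C2).symm L with hvdef
  have hv : ‖v‖ ≤ 1 := by simpa [v] using hL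
  have hve : inner ℝ v e = 1 := by rw [hvdef, InnerProductSpace.toDual_symm_apply, h]
  have h2 := norm_sub_sq_real v e
  rw [hve, he] at h2
  have h3 : ‖v - e‖ ^ 2 ≤ 0 := by nlinarith [norm_nonneg v]
  have h4 : ‖v - e‖ = 0 := by nlinarith [norm_nonneg (v - e)]
  exact sub_eq_zero.1 (norm_eq_zero.1 h4)

/-! ### Local defining functions -/

/-- `r` is a smooth function on the open set `V` whose negativity set there is `Ω`. -/
structure IsLocalDefining (Ω V : Set C2) (r : C2 → ℝ) : Prop where
  isOpen : IsOpen V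
  contDiffOn : ContDiffOn ℝ ∞ r V
  mem_iff : ∀ x ∈ V, x ∈ Ω ↔ r x < 0

namespace IsLocalDefining

variable {Ω V : Set C2} {r : C2 → ℝ}

theorem contDiffAt (h : IsLocalDefining Ω V r) {p : C2} (hp : p ∈ V) : ContDiffAt ℝ ∞ r p :=
  h.contDiffOn.contDiffAt (h.isOpen.mem_nhds hp)

theorem continuousAt (h : IsLocalDefining Ω V r) {p : C2} (hp : p ∈ V) : ContinuousAt r p :=
  (h.contDiffAt hp).continuousAt

theorem hasStrictFDerivAt (h : IsLocalDefining Ω V r) {p : C2} (hp : p ∈ V) :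
    HasStrictFDerivAt r (fderiv ℝ r p) p :=
  (h.contDiffAt hp).hasStrictFDerivAt (by simp)

theorem notMem_closure (h : IsLocalDefining Ω V r) {p : C2} (hp : p ∈ V) (hr : 0 < r p) :
    p ∉ closure Ω := by
  intro hc
  have h1 : ∀ᶠ x in 𝓝 p, x ∈ V ∧ 0 < r x :=
    (h.isOpen.eventually_mem hp).and ((h.continuousAt hp).eventually (eventually_gt_nhds hr))
  obtain ⟨x, hx, hxV, hxr⟩ := ((mem_closure_iff_frequently.1 hc).and_eventually h1).exists
  exact absurd ((h.mem_iff x hxV).1 hx) (not_lt.2 hxr.le)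

theorem eq_zero (h : IsLocalDefining Ω V r) {p : C2} (hp : p ∈ V) (hf : p ∈ frontier Ω)
    (ho : IsOpen Ω) : r p = 0 := by
  rw [ho.frontier_eq] at hf
  refine le_antisymm ?_ (not_lt.1 fun hn => hf.2 ((h.mem_iff p hp).2 hn))
  by_contra hpos
  exact h.notMem_closure hp (not_le.1 hpos) hf.1

set_option maxHeartbeats 800000 in
/-- The signed distance is differentiable at regular boundary points. -/
theorem hasFDerivAt_signedBoundaryDist (h : IsLocalDefining Ω V r) (ho : IsOpen Ω) {p : C2}
    (hp : p ∈ V) (hf : p ∈ frontier Ω) (hr : fderiv ℝ r p ≠ 0) :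
    HasFDerivAt (signedBoundaryDist Ω) (‖fderiv ℝ r p‖⁻¹ • fderiv ℝ r p) p := by
  set L := fderiv ℝ r p with hL
  have hL0 : 0 < ‖L‖ := norm_pos_iff.2 hr
  obtain ⟨e, he, hLe⟩ := exists_unit_apply_eq_norm hr
  have hrp := h.eq_zero hp hf ho
  rw [hasFDerivAt_iff_isLittleO, Asymptotics.isLittleO_iff]
  intro c hc
  rw [signedBoundaryDist_frontier hf]
  -- a constant for the strict differentiability of `r`
  obtain ⟨k, hk0, hk8⟩ : ∃ k : ℝ, 0 < k ∧ 16 * k = min c 1 * ‖L‖ :=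
    ⟨min c 1 * ‖L‖ / 16, by positivity, by ring⟩
  have hkc : 16 * k ≤ c * ‖L‖ := by
    rw [hk8]; exact mul_le_mul_of_nonneg_right (min_le_left _ _) hL0.le
  have hk1 : 16 * k ≤ ‖L‖ := by
    rw [hk8]; exact mul_le_of_le_one_left hL0.le (min_le_right _ _)
  have hs := (h.hasStrictFDerivAt hp).isLittleO.def hk0
  have hs' : ∀ᶠ x in 𝓝 (p, p), (x.1 ∈ V ∧ x.2 ∈ V) ∧
      ‖r x.1 - r x.2 - L (x.1 - x.2)‖ ≤ k * ‖x.1 - x.2‖ :=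
    (((h.isOpen.prod h.isOpen).eventually_mem
      (show (p, p) ∈ V ×ˢ V from ⟨hp, hp⟩)).mono fun x hx => ⟨hx.1, hx.2⟩).and hs
  obtain ⟨ρ, hρ, hball⟩ := Metric.eventually_nhds_iff.1 hs'
  have key : ∀ x y : C2, ‖x - p‖ < ρ → ‖y - p‖ < ρ → (x ∈ V ∧ y ∈ V) ∧
      |r x - r y - L (x - y)| ≤ k * ‖x - y‖ := fun x y hx hy => by
    have := hball (y := (x, y)) (by
      rw [Prod.dist_eq, dist_eq_norm, dist_eq_norm]; exact max_lt hx hy)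
    simpa using this
  have hev : ∀ᶠ q in 𝓝 p, ‖q - p‖ < ρ / 4 := by
    filter_upwards [Metric.ball_mem_nhds p (show 0 < ρ / 4 by positivity)] with q hq
    rwa [mem_ball_iff_norm] at hq
  filter_upwards [hev] with q hq
  set t := ‖q - p‖ with ht
  have ht0 : 0 ≤ t := norm_nonneg _
  -- `s` is the signed distance predicted by the linearisation of `r`; the rest compares it with `D
  -- q`.
  obtain ⟨s, hs⟩ : ∃ s, s = ‖L‖⁻¹ * L (q - p) := ⟨_, rfl⟩
  have hsL : L (q - p) = ‖L‖ * s := by rw [hs]; field_simp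
  have hst : |s| ≤ t := by
    have : ‖L (q - p)‖ ≤ ‖L‖ * t := L.le_opNorm _
    rw [hsL, norm_mul, norm_norm, Real.norm_eq_abs] at this
    exact le_of_mul_le_mul_left this hL0
  set D := signedBoundaryDist Ω with hD
  have hqV := (key q p (by linarith) (by simpa using hρ)).1.1
  -- lower bound
  have hlow : |s| ≤ |D q| + c / 4 * t := by
    -- At a nearest boundary point `y`, `r` vanishes as it does at `p`, so `L (y - p)` is only an
    -- error term and `L (q - p)` is controlled by `‖L‖ * ‖q - y‖`.
    obtain ⟨y, hy, hyq⟩ := exists_frontier_norm_eq ⟨p, hf⟩ q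
    have hyq' : ‖q - y‖ ≤ t := hyq ▸ abs_signedBoundaryDist_le hf q
    have hyp : ‖y - p‖ ≤ 2 * t := by
      calc ‖y - p‖ = ‖(q - p) - (q - y)‖ := by congr 1; abel
        _ ≤ t + ‖q - y‖ := norm_sub_le _ _
        _ ≤ 2 * t := by linarith
    have hk := key y p (by linarith) (by simpa using hρ)
    rw [h.eq_zero hk.1.1 hy ho, hrp, sub_zero, zero_sub, abs_neg] at hk
    have h1 : |L (q - p)| ≤ |L (q - y)| + |L (y - p)| := by
      rw [← sub_add_sub_cancel q y p, map_add]; exact abs_add_le _ _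
    have h2 : |L (q - y)| ≤ ‖L‖ * |D q| := by rw [← hyq]; exact L.le_opNorm _
    have h3 : ‖L‖ * |s| ≤ ‖L‖ * |D q| + k * (2 * t) := by
      rw [hsL, abs_mul, abs_norm] at h1
      have := mul_le_mul_of_nonneg_left hyp hk0.le
      linarith [hk.2]
    have h4 : k * (2 * t) ≤ ‖L‖ * (c / 4 * t) := by nlinarith
    exact le_of_mul_le_mul_left (by linarith) hL0
  -- upper bound
  have hup : |D q| ≤ |s| + c / 4 * t := by
    rcases ht0.eq_or_lt with h0 | htpos
    · have := abs_signedBoundaryDist_le hf q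
      rw [← ht, ← h0] at this
      rw [← h0]
      linarith [abs_nonneg s]
    -- The point `q - s • e` lies on the tangent hyperplane at `p`. A further shift by `± j t` along
    -- `e` has first-order effect `± 4 k t` on `r`, which beats the error `3 k t` and decides the
    -- side of the boundary, while moving the point by at most `c / 4 * t`.
    set j := min c 1 / 4 with hj
    have hj0 : 0 < j := by positivity
    have hjc : j ≤ c / 4 := div_le_div_of_nonneg_right (min_le_left _ _) (by norm_num)
    have hj1 : j ≤ 1 := by
      have := min_le_right c 1
      rw [hj]; linarith
    have hkj : 4 * k = j * ‖L‖ := by rw [hj]; linarith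
    have hsub : ∀ σ : ℝ, |σ| = 1 → ‖q - s • e + (σ * j * t) • e - p‖ ≤ 3 * t ∧
        L (q - s • e + (σ * j * t) • e - p) = σ * (j * ‖L‖ * t) := by
      intro σ hσ
      constructor
      · calc ‖q - s • e + (σ * j * t) • e - p‖ = ‖(q - p) - s • e + (σ * j * t) • e‖ := by
              congr 1; abel
          _ ≤ ‖q - p‖ + ‖s • e‖ + ‖(σ * j * t) • e‖ :=
            (norm_add_le _ _).trans (by gcongr; exact norm_sub_le _ _)
          _ ≤ t + t + t := by
            rw [norm_smul, norm_smul, he, mul_one, mul_one, Real.norm_eq_abs, Real.norm_eq_abs,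
              abs_mul, abs_mul, hσ, abs_of_pos hj0, abs_of_pos htpos]
            have : j * t ≤ 1 * t := mul_le_mul_of_nonneg_right hj1 ht0
            linarith
          _ = 3 * t := by ring
      · have : q - s • e + (σ * j * t) • e - p = (q - p) - s • e + (σ * j * t) • e := by abel
        rw [this, map_add, map_sub, map_smul, map_smul, hLe, hsL, smul_eq_mul, smul_eq_mul]
        ring
    have hclose : ∀ σ : ℝ, |σ| = 1 →
        dist (q - s • e) (q - s • e + (σ * j * t) • e) ≤ c / 4 * t := by
      intro σ hσ
      rw [dist_self_add_right, norm_smul, he, mul_one, Real.norm_eq_abs, abs_mul, abs_mul, hσ,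
        abs_of_pos hj0, abs_of_pos htpos, one_mul]
      exact mul_le_mul_of_nonneg_right hjc ht0
    have hDs : |D q - D (q - s • e)| ≤ |s| := by
      have := (lipschitzWith_signedBoundaryDist Ω).dist_le_mul q (q - s • e)
      rwa [Real.dist_eq, dist_eq_norm, sub_sub_cancel, norm_smul, he, mul_one, NNReal.coe_one,
        one_mul, Real.norm_eq_abs] at this
    have hD0 : |D (q - s • e)| ≤ c / 4 * t := by
      have hjt : 0 < j * ‖L‖ * t := by positivity
      rw [abs_le]
      constructor
      · obtain ⟨h1, h2⟩ := hsub 1 (by simp)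
        have hk := key _ p (by linarith) (by simpa using hρ)
        have h3 : 0 < r (q - s • e + (1 * j * t) • e) := by
          have h4 := (abs_le.1 hk.2).1
          rw [hrp, h2] at h4
          nlinarith
        have h5 : q - s • e + (1 * j * t) • e ∉ Ω := fun hm =>
          absurd ((h.mem_iff _ hk.1.1).1 hm) (not_lt.2 h3.le)
        have h6 := signedBoundaryDist_nonneg h5
        have h7 := signedBoundaryDist_sub_le Ω (q - s • e + (1 * j * t) • e) (q - s • e)
        rw [dist_comm] at h7
        linarith [hclose 1 (by simp)]
      · obtain ⟨h1, h2⟩ := hsub (-1) (by simp)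
        have hk := key _ p (by linarith) (by simpa using hρ)
        have h3 : r (q - s • e + (-1 * j * t) • e) < 0 := by
          have h4 := (abs_le.1 hk.2).2
          rw [hrp, h2] at h4
          nlinarith
        have h6 := signedBoundaryDist_of_mem ((h.mem_iff _ hk.1.1).2 h3)
        have h8 := Metric.infDist_nonneg (s := frontier Ω) (x := q - s • e + (-1 * j * t) • e)
        have h7 := signedBoundaryDist_sub_le Ω (q - s • e) (q - s • e + (-1 * j * t) • e)
        linarith [hclose (-1) (by simp)]
    have := abs_add_le (D q - D (q - s • e)) (D (q - s • e))
    rw [sub_add_cancel] at this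
    linarith
  -- sign
  have hsign : (0 ≤ D q → -(c / 4 * t) ≤ s) ∧ (D q ≤ 0 → s ≤ c / 4 * t) := by
    -- The bounds on absolute values leave the sign open; the sign of `r q` settles it up to an
    -- error `c / 4 * t`.
    have h1 := (key q p (by linarith) (by simpa using hρ)).2
    rw [hrp, sub_zero, hsL] at h1
    have hkt : k * t ≤ ‖L‖ * (c / 4 * t) := by nlinarith
    by_cases hq : q ∈ Ω
    · have h2 := (h.mem_iff q hqV).1 hq
      refine ⟨fun h0 => ?_, fun _ => ?_⟩
      · have h3 : D q = 0 := le_antisymm (by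
          rw [hD, signedBoundaryDist_of_mem hq]
          linarith [Metric.infDist_nonneg (s := frontier Ω) (x := q)]) h0
        rw [h3, abs_zero] at hlow
        linarith [neg_abs_le s]
      · exact le_of_mul_le_mul_left (by linarith [(abs_le.1 h1).1]) hL0
    · have h2 : 0 ≤ r q := not_lt.1 fun hn => hq ((h.mem_iff q hqV).2 hn)
      refine ⟨fun _ => ?_, fun h0 => ?_⟩
      · exact le_of_mul_le_mul_left (by linarith [(abs_le.1 h1).2]) hL0
      · have h3 : D q = 0 := le_antisymm h0 (signedBoundaryDist_nonneg hq)
        rw [h3, abs_zero] at hlow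
        linarith [le_abs_self s]
  have hfin : |D q - s| ≤ c * t := by
    rcases le_total 0 (D q) with h0 | h0
    · have h5 := hsign.1 h0
      rw [abs_of_nonneg h0] at hlow hup
      rw [abs_le]
      have hct : 0 ≤ c * t := by positivity
      rcases le_total 0 s with h6 | h6
      · rw [abs_of_nonneg h6] at hlow hup; constructor <;> linarith
      · rw [abs_of_nonpos h6] at hlow hup; constructor <;> linarith
    · have h5 := hsign.2 h0
      rw [abs_of_nonpos h0] at hlow hup
      rw [abs_le]
      have hct : 0 ≤ c * t := by positivity
      rcases le_total 0 s with h6 | h6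
      · rw [abs_of_nonneg h6] at hlow hup; constructor <;> linarith
      · rw [abs_of_nonpos h6] at hlow hup; constructor <;> linarith
  rw [sub_zero, smul_apply, smul_eq_mul, ← hs]
  exact hfin

end IsLocalDefining

theorem HasFDerivAt.hasDerivAt_line {E F : Type*} [NormedAddCommGroup E] [NormedSpace ℝ E]
    [NormedAddCommGroup F] [NormedSpace ℝ F] {f : E → F} {L : E →L[ℝ] F} {x v : E} {s : ℝ}
    (hf : HasFDerivAt f L (x + s • v)) : HasDerivAt (fun t : ℝ => f (x + t • v)) (L v) s := by
  have hl : HasDerivAt (fun t : ℝ => x + t • v) v s := by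
    simpa using ((hasDerivAt_id s).smul_const v).const_add x
  exact hf.comp_hasDerivAt s hl

theorem HasFDerivAt.hasDerivAt_line_zero {E F : Type*} [NormedAddCommGroup E] [NormedSpace ℝ E]
    [NormedAddCommGroup F] [NormedSpace ℝ F] {f : E → F} {L : E →L[ℝ] F} {x v : E}
    (hf : HasFDerivAt f L x) : HasDerivAt (fun t : ℝ => f (x + t • v)) (L v) 0 :=
  HasFDerivAt.hasDerivAt_line (by rwa [zero_smul, add_zero])

/-! ### Nearest boundary points -/

theorem fderiv_ofReal_comp_apply (g : C2 → ℝ) (q v : C2) :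
    fderiv ℝ (fun p => (g p : ℂ)) q v = (fderiv ℝ g q v : ℂ) := by
  by_cases hg : DifferentiableAt ℝ g q
  · have := Complex.ofRealCLM.hasFDerivAt.comp q hg.hasFDerivAt
    have h2 : fderiv ℝ (fun p => (g p : ℂ)) q = Complex.ofRealCLM.comp (fderiv ℝ g q) := this.fderiv
    rw [h2]; rfl
  · have h2 : ¬ DifferentiableAt ℝ (fun p => (g p : ℂ)) q := fun h => hg <| by
      have := Complex.reCLM.differentiableAt.comp q h
      exact this
    rw [fderiv_zero_of_not_differentiableAt hg, fderiv_zero_of_not_differentiableAt h2]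
    simp

theorem dZbar_ofReal_comp (j : Fin 2) (g : C2 → ℝ) (q : C2) :
    dZbar j (fun p => (g p : ℂ)) q = (1 / 2) * ((fderiv ℝ g q (EuclideanSpace.single j 1) : ℂ)
      + Complex.I * (fderiv ℝ g q (EuclideanSpace.single j Complex.I) : ℂ)) := by
  simp only [dZbar, fderiv_ofReal_comp_apply]

/-- The Lipschitz bounds from the two ends `y` and `q` squeeze the value. -/
theorem signedBoundaryDist_segment {Ω : Set C2} {q y e : C2} (hy : y ∈ frontier Ω)
    (he : ‖e‖ = 1) {D s : ℝ} (hq : signedBoundaryDist Ω q = D) (hqe : q = y + D • e)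
    (hs : s ∈ Set.Icc 0 D) : signedBoundaryDist Ω (y + s • e) = s := by
  have h1 := signedBoundaryDist_sub_le Ω (y + s • e) y
  have h2 := signedBoundaryDist_sub_le Ω q (y + s • e)
  rw [signedBoundaryDist_frontier hy, dist_self_add_left, norm_smul, he, Real.norm_eq_abs,
    abs_of_nonneg hs.1] at h1
  have h3 : q - (y + s • e) = (D - s) • e := by rw [hqe, sub_smul]; abel
  rw [dist_eq_norm, h3, norm_smul, he, Real.norm_eq_abs, abs_of_nonneg (by linarith [hs.2]), hq]
    at h2
  linarith

theorem fderiv_apply_eq_one_of_segment {Ω : Set C2} {q y e : C2} (hy : y ∈ frontier Ω)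
    (he : ‖e‖ = 1) {D s : ℝ} (hD : 0 < D) (hq : signedBoundaryDist Ω q = D) (hqe : q = y + D • e)
    (hs : s ∈ Set.Icc 0 D) (hd : DifferentiableAt ℝ (signedBoundaryDist Ω) (y + s • e)) :
    fderiv ℝ (signedBoundaryDist Ω) (y + s • e) e = 1 := by
  have h1 : HasDerivAt (fun t : ℝ => signedBoundaryDist Ω (y + t • e))
      (fderiv ℝ (signedBoundaryDist Ω) (y + s • e) e) s := hd.hasFDerivAt.hasDerivAt_line
  have h2 : HasDerivWithinAt (fun t : ℝ => signedBoundaryDist Ω (y + t • e)) 1 (Set.Icc 0 D) s :=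
    (hasDerivWithinAt_id s _).congr (fun t ht => signedBoundaryDist_segment hy he hq hqe ht)
      (signedBoundaryDist_segment hy he hq hqe hs)
  -- At the ends of the segment the distance is known on one side only; since differentiability is
  -- assumed, the one-sided derivative suffices.
  exact ((uniqueDiffOn_Icc hD) s hs).eq_deriv _ h1.hasDerivWithinAt h2

/-- The signed distance has the same gradient at an exterior point and at a nearest boundary
point, namely the unit vector between them. -/
theorem gradient_eq_of_nearest {Ω : Set C2} {q y : C2} (hy : y ∈ frontier Ω)
    (hq : 0 < signedBoundaryDist Ω q) (hqy : ‖q - y‖ = signedBoundaryDist Ω q)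
    (hdy : DifferentiableAt ℝ (signedBoundaryDist Ω) y) :
    q = y + signedBoundaryDist Ω q •
        (InnerProductSpace.toDual ℝ C2).symm (fderiv ℝ (signedBoundaryDist Ω) y) ∧
      (DifferentiableAt ℝ (signedBoundaryDist Ω) q →
        fderiv ℝ (signedBoundaryDist Ω) q = fderiv ℝ (signedBoundaryDist Ω) y) := by
  obtain ⟨D, hD⟩ : ∃ D, D = signedBoundaryDist Ω q := ⟨_, rfl⟩
  rw [← hD] at hq hqy ⊢
  set e : C2 := D⁻¹ • (q - y) with hedef
  have he : ‖e‖ = 1 := by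
    rw [hedef, norm_smul, hqy, norm_inv, Real.norm_eq_abs, abs_of_pos hq, inv_mul_cancel₀ hq.ne']
  have hqe : q = y + D • e := by
    rw [hedef, smul_smul, mul_inv_cancel₀ hq.ne', one_smul]; abel
  have h1 := fderiv_apply_eq_one_of_segment (s := 0) hy he hq hD.symm hqe
    ⟨le_rfl, hq.le⟩ (by simpa using hdy)
  rw [zero_smul, add_zero] at h1
  have h2 := toDual_symm_eq_of_apply_eq_one (norm_fderiv_signedBoundaryDist_le Ω y) he h1
  refine ⟨by rw [h2]; exact hqe, fun hdq => ?_⟩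
  have h3 := fderiv_apply_eq_one_of_segment (s := D) hy he hq hD.symm hqe
    ⟨hq.le, le_rfl⟩ (by rwa [← hqe])
  rw [← hqe] at h3
  have h4 := toDual_symm_eq_of_apply_eq_one (norm_fderiv_signedBoundaryDist_le Ω q) he h3
  exact (InnerProductSpace.toDual ℝ C2).symm.injective (h4.trans h2.symm)

/-- Tangent vectors are velocities of boundary curves. -/
theorem exists_frontier_curve {Ω : Set C2} {p T : C2} (hp : p ∈ frontier Ω) {L : C2 →L[ℝ] ℝ}
    (hL : HasFDerivAt (signedBoundaryDist Ω) L p) (hT : L T = 0) :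
    ∃ y : ℝ → C2, (∀ s, y s ∈ frontier Ω) ∧ y 0 = p ∧ HasDerivAt y T 0 := by
  -- A nearest boundary point to `p + s • T` lies at distance |δ(p + sT)| from it, which is o(s)
  -- because `L T = 0`. The choice may be discontinuous for `s ≠ 0`; only the derivative at `0`
  -- matters.
  choose y hy hyn using fun s : ℝ => exists_frontier_norm_eq ⟨p, hp⟩ (p + s • T)
  have hl : HasDerivAt (fun t : ℝ => p + t • T) T 0 := by
    simpa using ((hasDerivAt_id (0 : ℝ)).smul_const T).const_add p
  have hy0 : y 0 = p := by
    have := hyn 0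
    rw [zero_smul, add_zero, signedBoundaryDist_frontier hp, abs_zero, norm_eq_zero] at this
    exact (sub_eq_zero.1 this).symm
  refine ⟨y, hy, hy0, ?_⟩
  have h1 : HasDerivAt (fun s : ℝ => signedBoundaryDist Ω (p + s • T)) 0 0 := by
    have h2 := hL.hasDerivAt_line_zero (v := T)
    rwa [hT] at h2
  have h3 : HasDerivAt (fun s : ℝ => y s - (p + s • T)) 0 0 := by
    rw [hasDerivAt_iff_isLittleO] at h1 ⊢
    refine Asymptotics.IsBigO.trans_isLittleO (Asymptotics.IsBigO.of_bound 1 ?_) h1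
    refine Eventually.of_forall fun s => ?_
    simp [signedBoundaryDist_frontier hp, hy0, ← hyn s, norm_sub_rev]
  refine ((h3.add hl).congr_of_eventuallyEq (Eventually.of_forall fun s => ?_)).congr_deriv
    (zero_add T)
  simp

/-- A product rule at a zero of `m`, where the other factor need only be continuous. It handles
factors `‖fderiv ℝ r‖` without differentiating them. -/
theorem HasDerivAt.smul_of_eq_zero {E : Type*} [NormedAddCommGroup E] [NormedSpace ℝ E]
    {R : ℝ → ℝ} {m : ℝ → E} {m' : E} {x : ℝ} (hm : HasDerivAt m m' x) (h0 : m x = 0)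
    (hR : ContinuousAt R x) : HasDerivAt (fun t => R t • m t) (R x • m') x := by
  rw [hasDerivAt_iff_tendsto_slope] at hm ⊢
  refine ((hR.tendsto.mono_left nhdsWithin_le_nhds).smul hm).congr fun t => ?_
  simp only [slope, vsub_eq_sub, h0, smul_zero, sub_zero]
  rw [smul_comm]

/-! ### Second-order behaviour of the signed distance at the boundary -/

namespace IsLocalDefining

variable {Ω V : Set C2} {r : C2 → ℝ}

theorem contDiffAt_fderiv (h : IsLocalDefining Ω V r) {p : C2} (hp : p ∈ V) :
    ContDiffAt ℝ ∞ (fderiv ℝ r) p :=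
  (h.contDiffAt hp).fderiv_right (by simp)

theorem eventually_regular (h : IsLocalDefining Ω V r) {p : C2} (hp : p ∈ V)
    (hr : fderiv ℝ r p ≠ 0) : ∀ᶠ x in 𝓝 p, x ∈ V ∧ fderiv ℝ r x ≠ 0 :=
  (h.isOpen.eventually_mem hp).and
    ((h.contDiffAt_fderiv hp).continuousAt.eventually_ne hr)

theorem fderiv_signedBoundaryDist (h : IsLocalDefining Ω V r) (ho : IsOpen Ω) {p : C2}
    (hp : p ∈ V) (hf : p ∈ frontier Ω) (hr : fderiv ℝ r p ≠ 0) :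
    fderiv ℝ (signedBoundaryDist Ω) p = ‖fderiv ℝ r p‖⁻¹ • fderiv ℝ r p :=
  (h.hasFDerivAt_signedBoundaryDist ho hp hf hr).fderiv

theorem fderiv_eq_smul (h : IsLocalDefining Ω V r) (ho : IsOpen Ω) {p : C2}
    (hp : p ∈ V) (hf : p ∈ frontier Ω) (hr : fderiv ℝ r p ≠ 0) :
    fderiv ℝ r p = ‖fderiv ℝ r p‖ • fderiv ℝ (signedBoundaryDist Ω) p := by
  rw [h.fderiv_signedBoundaryDist ho hp hf hr, smul_smul, mul_inv_cancel₀ (norm_ne_zero_iff.2 hr),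
    one_smul]

theorem continuousWithinAt_fderiv_signedBoundaryDist (h : IsLocalDefining Ω V r) (ho : IsOpen Ω)
    {p : C2} (hp : p ∈ V) (hf : p ∈ frontier Ω) (hr : fderiv ℝ r p ≠ 0) :
    ContinuousWithinAt (fderiv ℝ (signedBoundaryDist Ω)) (frontier Ω) p := by
  have h1 : ContinuousAt (fun x => ‖fderiv ℝ r x‖⁻¹ • fderiv ℝ r x) p := by
    have h2 := (h.contDiffAt_fderiv hp).continuousAt
    exact (h2.norm.inv₀ (norm_ne_zero_iff.2 hr)).smul h2
  refine h1.continuousWithinAt.congr_of_eventuallyEq ?_ (h.fderiv_signedBoundaryDist ho hp hf hr)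
  filter_upwards [nhdsWithin_le_nhds (h.eventually_regular hp hr), self_mem_nhdsWithin] with x hx hxf
  exact h.fderiv_signedBoundaryDist ho hx.1 hxf hx.2

/-- A first derivative of the signed distance, where it is differentiable and vanishes, has
vanishing derivative in the normal direction. -/
theorem fderiv_dZbar_normal (h : IsLocalDefining Ω V r) (ho : IsOpen Ω) {p : C2}
    (hp : p ∈ V) (hf : p ∈ frontier Ω) (hr : fderiv ℝ r p ≠ 0) {n : C2} (hn : ‖n‖ = 1)
    (hLn : fderiv ℝ (signedBoundaryDist Ω) p n = 1) {f : C2 → ℂ} {j : Fin 2}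
    (hfdef : f = dZbar j (fun p => (signedBoundaryDist Ω p : ℂ)))
    (hfd : DifferentiableAt ℝ f p) (hf0 : f p = 0) : fderiv ℝ f p n = 0 := by
  have hgrad := toDual_symm_eq_of_apply_eq_one (norm_fderiv_signedBoundaryDist_le Ω p) hn hLn
  have hdp := (h.hasFDerivAt_signedBoundaryDist ho hp hf hr).differentiableAt
  have hD1 : HasDerivAt (fun t : ℝ => signedBoundaryDist Ω (p + t • n)) 1 0 := by
    have h2 := hdp.hasFDerivAt.hasDerivAt_line_zero (v := n)
    rwa [hLn] at h2
  have hF1 : HasDerivAt (fun t : ℝ => f (p + t • n)) (fderiv ℝ f p n) 0 :=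
    hfd.hasFDerivAt.hasDerivAt_line_zero
  obtain ⟨K, hK0, hK⟩ := hfd.hasFDerivAt.isBigO_sub.exists_pos
  have hK := hK.bound
  -- it suffices to bound the values of `f` along the normal
  suffices hsuff : ∀ c : ℝ, 0 < c → ∀ᶠ t in 𝓝[>] (0 : ℝ), ‖f (p + t • n)‖ ≤ K * (2 * c * t) by
    have hlim : Tendsto (fun t : ℝ => ‖t⁻¹ • f (p + t • n)‖) (𝓝[>] 0) (𝓝 ‖fderiv ℝ f p n‖) := by
      have := (hasDerivAt_iff_tendsto_slope.1 hF1).mono_left (nhdsGT_le_nhdsNE (0 : ℝ))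
      refine this.norm.congr fun t => ?_
      simp [slope, hf0]
    have hle : ∀ c : ℝ, 0 < c → ‖fderiv ℝ f p n‖ ≤ K * (2 * c) := fun c hc => by
      refine le_of_tendsto hlim ?_
      filter_upwards [hsuff c hc, self_mem_nhdsWithin] with t ht ht0
      have ht0 : (0 : ℝ) < t := ht0
      rw [norm_smul, norm_inv, Real.norm_eq_abs, abs_of_pos ht0, inv_mul_le_iff₀ ht0]
      linarith
    refine norm_le_zero_iff.1 (le_of_forall_pos_le_add fun ε hε => ?_)
    have := hle (ε / (2 * K)) (by positivity)
    rw [zero_add]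
    refine this.trans_eq ?_
    field_simp
  intro c hc
  have hcont := h.continuousWithinAt_fderiv_signedBoundaryDist ho hp hf hr
  have hE1 : ∀ᶠ y in 𝓝 p, y ∈ frontier Ω →
      ‖(InnerProductSpace.toDual ℝ C2).symm (fderiv ℝ (signedBoundaryDist Ω) y) - n‖ < c := by
    have h1 := (InnerProductSpace.toDual ℝ C2).symm.continuous.continuousAt.comp_continuousWithinAt
      hcont
    have h2 := Metric.tendsto_nhds.1 h1 c hc
    rw [eventually_nhdsWithin_iff] at h2
    filter_upwards [h2] with y hy hyf
    have h3 := hy hyf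
    rwa [dist_eq_norm, Function.comp_apply, Function.comp_apply, hgrad] at h3
  have hE := (hE1.and (h.eventually_regular hp hr)).and hK
  obtain ⟨ρ, hρ, hball⟩ := Metric.eventually_nhds_iff.1 hE
  have hsmall : ∀ᶠ t in 𝓝[>] (0 : ℝ), t < ρ / 2 :=
    nhdsWithin_le_nhds (eventually_lt_nhds (by positivity))
  have hDlow : ∀ᶠ t in 𝓝[>] (0 : ℝ), |signedBoundaryDist Ω (p + t • n) - t| ≤ min c (1 / 2) * t := by
    have h1 := (hasDerivAt_iff_isLittleO.1 hD1).def (show 0 < min c (1 / 2) by positivity)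
    filter_upwards [nhdsWithin_le_nhds h1, self_mem_nhdsWithin] with t ht ht0
    have ht0 : (0 : ℝ) < t := ht0
    simpa [signedBoundaryDist_frontier hf, abs_of_pos ht0] using ht
  filter_upwards [hsmall, hDlow, self_mem_nhdsWithin] with t ht hDt ht0
  have ht0 : (0 : ℝ) < t := ht0
  set q := p + t • n with hq
  -- Where δ is not differentiable its `fderiv` is zero by convention, and so is `f q`. Otherwise `f
  -- q = f y` at a nearest boundary point `y`, and `y` is within o(t) of `p`.
  by_cases hdq : DifferentiableAt ℝ (signedBoundaryDist Ω) q
  swap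
  · have : f q = 0 := by
      rw [hfdef, dZbar_ofReal_comp, fderiv_zero_of_not_differentiableAt hdq]; simp
    rw [this, norm_zero]; positivity
  have hct : min c (1 / 2) * t ≤ c * t := mul_le_mul_of_nonneg_right (min_le_left _ _) ht0.le
  have hct2 : min c (1 / 2) * t ≤ 1 / 2 * t :=
    mul_le_mul_of_nonneg_right (min_le_right _ _) ht0.le
  have hDpos : 0 < signedBoundaryDist Ω q := by linarith [(abs_le.1 hDt).1]
  obtain ⟨y, hy, hyq⟩ := exists_frontier_norm_eq ⟨p, hf⟩ q
  rw [abs_of_pos hDpos] at hyq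
  have hqp : ‖q - p‖ = t := by
    rw [hq, add_sub_cancel_left, norm_smul, hn, mul_one, Real.norm_eq_abs, abs_of_pos ht0]
  have hDle : signedBoundaryDist Ω q ≤ t := by
    have := abs_signedBoundaryDist_le hf q
    rwa [hqp, abs_of_pos hDpos] at this
  have hyp : ‖y - p‖ < ρ := by
    calc ‖y - p‖ = ‖(q - p) - (q - y)‖ := by congr 1; abel
      _ ≤ ‖q - p‖ + ‖q - y‖ := norm_sub_le _ _
      _ < ρ := by rw [hqp, hyq]; linarith
  obtain ⟨⟨hyn, hyV, hyr⟩, hyK⟩ := hball (y := y) (by rwa [dist_eq_norm])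
  obtain ⟨hqy, hfd⟩ := gradient_eq_of_nearest hy hDpos hyq
    (h.hasFDerivAt_signedBoundaryDist ho hyV hy hyr).differentiableAt
  set e := (InnerProductSpace.toDual ℝ C2).symm (fderiv ℝ (signedBoundaryDist Ω) y)
  have hfqy : f q = f y := by rw [hfdef, dZbar_ofReal_comp, dZbar_ofReal_comp, hfd hdq]
  have hyp2 : ‖y - p‖ ≤ 2 * c * t := by
    -- Compare `q = p + t • n` with `q = y + δ(q) • e`. Both terms are o(t): δ(q) = t + o(t), and
    -- `e` is close to `n` by continuity of the gradient along the boundary.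
    have h1 : y - p = (t - signedBoundaryDist Ω q) • n - signedBoundaryDist Ω q • (e - n) := by
      have : y = p + t • n - signedBoundaryDist Ω q • e := by
        rw [← hq]; exact eq_sub_of_add_eq hqy.symm
      rw [this, sub_smul, smul_sub]; abel
    rw [h1]
    refine (norm_sub_le _ _).trans ?_
    rw [norm_smul, norm_smul, hn, mul_one, Real.norm_eq_abs, Real.norm_eq_abs, abs_of_pos hDpos,
      abs_sub_comm]
    have h2 := mul_le_mul hDle (hyn hy).le (norm_nonneg _) ht0.le
    linarith
  rw [hf0, sub_zero] at hyK
  rw [hfqy]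
  exact hyK.trans (mul_le_mul_of_nonneg_left hyp2 hK0.le)

/-- The tangential derivative of a first derivative of the signed distance, at a point where
it vanishes. -/
theorem fderiv_dZbar_tangential (h : IsLocalDefining Ω V r) (ho : IsOpen Ω) {p : C2}
    (hp : p ∈ V) (hf : p ∈ frontier Ω) (hr : fderiv ℝ r p ≠ 0) {T : C2}
    (hLT : fderiv ℝ r p T = 0) {f : C2 → ℂ} {j : Fin 2}
    (hfdef : f = dZbar j (fun p => (signedBoundaryDist Ω p : ℂ)))
    (hfd : DifferentiableAt ℝ f p) (hf0 : f p = 0) :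
    ‖fderiv ℝ r p‖ • fderiv ℝ f p T =
      (1 / 2) * ((fderiv ℝ (fderiv ℝ r) p T (EuclideanSpace.single j 1) : ℂ)
        + Complex.I * (fderiv ℝ (fderiv ℝ r) p T (EuclideanSpace.single j Complex.I) : ℂ)) := by
  obtain ⟨y, hyf, hy0, hyd⟩ := exists_frontier_curve (T := T) hf
    (h.hasFDerivAt_signedBoundaryDist ho hp hf hr) (by simp [hLT])
  have hfy : HasDerivAt (fun t => f (y t)) (fderiv ℝ f p T) 0 := by
    have h2 : HasFDerivAt f (fderiv ℝ f p) (y 0) := by rw [hy0]; exact hfd.hasFDerivAt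
    exact h2.comp_hasDerivAt (0 : ℝ) hyd
  have hcr : ContinuousAt (fun t => ‖fderiv ℝ r (y t)‖) 0 := by
    have h2 : ContinuousAt (fderiv ℝ r) (y 0) := by
      rw [hy0]; exact (h.contDiffAt_fderiv hp).continuousAt
    exact (ContinuousAt.comp (f := y) h2 hyd.continuousAt).norm
  have h1 := hfy.smul_of_eq_zero (by rw [hy0, hf0]) hcr
  rw [hy0] at h1
  have hDr : HasDerivAt (fun t => fderiv ℝ r (y t)) (fderiv ℝ (fderiv ℝ r) p T) 0 := by
    have h2 : HasFDerivAt (fderiv ℝ r) (fderiv ℝ (fderiv ℝ r) p) (y 0) := by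
      rw [hy0]; exact ((h.contDiffAt_fderiv hp).differentiableAt (by simp)).hasFDerivAt
    exact h2.comp_hasDerivAt (0 : ℝ) hyd
  have hv : ∀ v : C2, HasDerivAt (fun t => ((fderiv ℝ r (y t) v : ℝ) : ℂ))
      ((fderiv ℝ (fderiv ℝ r) p T v : ℝ) : ℂ) 0 := fun v =>
    ((ContinuousLinearMap.apply ℝ ℝ v).hasFDerivAt.comp_hasDerivAt (0 : ℝ) hDr).ofReal_comp
  have h2 := ((hv (EuclideanSpace.single j 1)).add
    ((hv (EuclideanSpace.single j Complex.I)).const_mul Complex.I)).const_mul (1 / 2 : ℂ)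
  -- On the boundary the differential of `r` is `‖fderiv ℝ r‖` times that of δ, so both functions of
  -- `t` are the `z̄_j`-derivative of `r` along the curve.
  refine h1.unique (h2.congr_of_eventuallyEq ?_)
  have hev : ∀ᶠ t in 𝓝 (0 : ℝ), y t ∈ V ∧ fderiv ℝ r (y t) ≠ 0 := by
    have := h.eventually_regular hp hr
    rw [← hy0] at this
    exact hyd.continuousAt.eventually this
  filter_upwards [hev] with t ht
  have hE : ∀ v, fderiv ℝ r (y t) v =
      ‖fderiv ℝ r (y t)‖ * fderiv ℝ (signedBoundaryDist Ω) (y t) v := fun v => by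
    conv_lhs => rw [h.fderiv_eq_smul ho ht.1 (hyf t) ht.2]
    rfl
  rw [hfdef, dZbar_ofReal_comp]
  simp only [Pi.add_apply]
  rw [hE, hE (EuclideanSpace.single j Complex.I), Complex.real_smul, Complex.ofReal_mul,
    Complex.ofReal_mul]
  ring

end IsLocalDefining

/-! ### The complex normal along a horizontal slice of the boundary -/

/-- The complex number `N` with `dδ(0, ζ) = Re (N ζ)` at the point `(z, w)`, where `δ` is the
signed distance. -/
noncomputable def complexNormal (Ω : Set C2) (w z : ℂ) : ℂ :=
  (fderiv ℝ (signedBoundaryDist Ω) !₂[z, w] (EuclideanSpace.single 1 1) : ℂ)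
    - Complex.I * (fderiv ℝ (signedBoundaryDist Ω) !₂[z, w] (EuclideanSpace.single 1 Complex.I) : ℂ)

theorem vec2_eq_single_add (a b : ℂ) :
    !₂[a, b] = EuclideanSpace.single (0 : Fin 2) a + EuclideanSpace.single (1 : Fin 2) b := by
  ext i; fin_cases i <;> simp

theorem single_one_eq_vec2 (a : ℂ) : EuclideanSpace.single (1 : Fin 2) a = !₂[0, a] := by
  ext i; fin_cases i <;> simp

theorem vec2_add_smul_single (z w e : ℂ) (x : ℝ) :
    (!₂[z, w] + x • EuclideanSpace.single (0 : Fin 2) e : C2) = !₂[z + x • e, w] := by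
  ext i; fin_cases i <;> simp

theorem single_real_decomp (j : Fin 2) (ζ : ℂ) : (EuclideanSpace.single j ζ : C2) =
    ζ.re • EuclideanSpace.single j 1 + ζ.im • EuclideanSpace.single j Complex.I := by
  ext i
  by_cases h : i = j
  · subst h; simp [Complex.re_add_im]
  · simp [h]

theorem clm_single_eq {F : Type*} [NormedAddCommGroup F] [NormedSpace ℝ F] (L : C2 →L[ℝ] F)
    (j : Fin 2) (ζ : ℂ) : L (EuclideanSpace.single j ζ) =
    ζ.re • L (EuclideanSpace.single j 1) + ζ.im • L (EuclideanSpace.single j Complex.I) := by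
  rw [single_real_decomp, map_add, map_smul, map_smul]

theorem fderiv_single_one_eq_re (Ω : Set C2) (w z ζ : ℂ) :
    fderiv ℝ (signedBoundaryDist Ω) !₂[z, w] (EuclideanSpace.single 1 ζ) =
      (complexNormal Ω w z * ζ).re := by
  rw [clm_single_eq, complexNormal]
  simp
  ring

theorem continuous_slice (w : ℂ) : Continuous fun z : ℂ => (!₂[z, w] : C2) := by
  refine (PiLp.continuous_toLp 2 _).comp (continuous_pi fun i => ?_)
  fin_cases i
  · exact continuous_id
  · exact continuous_const

theorem continuous_blowup (w : ℂ) :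
    Continuous fun x : (ℂ × ℂ) × ℝ => (!₂[x.1.1, w + x.2 * x.1.2] : C2) := by
  refine (PiLp.continuous_toLp 2 _).comp (continuous_pi fun i => ?_)
  fin_cases i
  · exact (by fun_prop : Continuous fun x : (ℂ × ℂ) × ℝ => x.1.1)
  · exact (by fun_prop : Continuous fun x : (ℂ × ℂ) × ℝ => w + x.2 * x.1.2)

theorem fderiv_single_zero_eq_zero {Ω : Set C2} {w z : ℂ}
    (hM : ∀ᶠ z' in 𝓝 z, !₂[z', w] ∈ frontier Ω)
    (hd : DifferentiableAt ℝ (signedBoundaryDist Ω) !₂[z, w]) (e : ℂ) :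
    fderiv ℝ (signedBoundaryDist Ω) !₂[z, w] (EuclideanSpace.single 0 e) = 0 := by
  have h1 := hd.hasFDerivAt.hasDerivAt_line_zero (v := EuclideanSpace.single 0 e)
  have h2 : ∀ᶠ x in 𝓝 (0 : ℝ), signedBoundaryDist Ω
      (!₂[z, w] + x • EuclideanSpace.single (0 : Fin 2) e) = 0 := by
    have hc : Tendsto (fun x : ℝ => z + x • e) (𝓝 0) (𝓝 z) := by
      have : Continuous fun x : ℝ => z + x • e := by fun_prop
      simpa using this.tendsto 0
    filter_upwards [hc.eventually hM] with x hx
    rw [vec2_add_smul_single, signedBoundaryDist_frontier hx]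
  exact h1.unique ((hasDerivAt_const (0 : ℝ) (0 : ℝ)).congr_of_eventuallyEq h2)

theorem fderiv_vec2_eq_re {Ω : Set C2} {w z : ℂ}
    (hM : ∀ᶠ z' in 𝓝 z, !₂[z', w] ∈ frontier Ω)
    (hd : DifferentiableAt ℝ (signedBoundaryDist Ω) !₂[z, w]) (a ζ : ℂ) :
    fderiv ℝ (signedBoundaryDist Ω) !₂[z, w] !₂[a, ζ] = (complexNormal Ω w z * ζ).re := by
  rw [vec2_eq_single_add a ζ, map_add, fderiv_single_zero_eq_zero hM hd, zero_add,
    fderiv_single_one_eq_re]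

namespace IsLocalDefining

variable {Ω V : Set C2} {r : C2 → ℝ} {w z : ℂ}

/-- At such a point dδ is the normalised differential of `r`, hence has norm one, and it depends on
the `w`-component alone. -/
theorem norm_complexNormal (h : IsLocalDefining Ω V r) (ho : IsOpen Ω)
    (hp : !₂[z, w] ∈ V) (hr : fderiv ℝ r !₂[z, w] ≠ 0)
    (hM : ∀ᶠ z' in 𝓝 z, !₂[z', w] ∈ frontier Ω) : ‖complexNormal Ω w z‖ = 1 := by
  have hf := hM.self_of_nhds
  have hd := (h.hasFDerivAt_signedBoundaryDist ho hp hf hr).differentiableAt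
  have hL := h.fderiv_signedBoundaryDist ho hp hf hr
  have hL1 : ‖fderiv ℝ (signedBoundaryDist Ω) !₂[z, w]‖ = 1 := by
    rw [hL, norm_smul, norm_inv, norm_norm, inv_mul_cancel₀ (norm_ne_zero_iff.2 hr)]
  set N := complexNormal Ω w z with hN
  apply le_antisymm
  · have h1 := fderiv_single_one_eq_re Ω w z (starRingEnd ℂ N)
    rw [← hN, Complex.mul_conj, Complex.ofReal_re, Complex.normSq_eq_norm_sq] at h1
    have h2 := (fderiv ℝ (signedBoundaryDist Ω) !₂[z, w]).le_opNorm
      (EuclideanSpace.single 1 (starRingEnd ℂ N))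
    rw [h1, hL1, one_mul, PiLp.norm_single, RCLike.norm_conj, norm_pow, norm_norm] at h2
    nlinarith [norm_nonneg N]
  · obtain ⟨e, he, hLe⟩ := exists_unit_apply_eq_norm
      (L := fderiv ℝ (signedBoundaryDist Ω) !₂[z, w]) (norm_ne_zero_iff.1 (by rw [hL1]; simp))
    have h1 : e = !₂[e 0, e 1] := by ext i; fin_cases i <;> simp
    rw [hL1, h1, fderiv_vec2_eq_re hM hd, ← hN] at hLe
    have h2 : ‖e 1‖ ≤ 1 := he ▸ PiLp.norm_apply_le e 1
    calc 1 = (N * e 1).re := hLe.symm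
      _ ≤ ‖N * e 1‖ := Complex.re_le_norm _
      _ = ‖N‖ * ‖e 1‖ := norm_mul _ _
      _ ≤ ‖N‖ * 1 := by gcongr
      _ = ‖N‖ := mul_one _

/-- The mixed second derivative of the signed distance measures the rotation of the complex
normal. -/
theorem norm_dZ_dZbar (h : IsLocalDefining Ω V r) (ho : IsOpen Ω)
    (hp : !₂[z, w] ∈ V) (hr : fderiv ℝ r !₂[z, w] ≠ 0)
    (hM : ∀ᶠ z' in 𝓝 z, !₂[z', w] ∈ frontier Ω) {φ : ℂ → ℝ}
    (hφ : ∀ᶠ z' in 𝓝 z, complexNormal Ω w z' = Complex.exp (φ z' * Complex.I))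
    (hφd : DifferentiableAt ℝ φ z)
    (hfd : DifferentiableAt ℝ (dZbar 0 (fun p => (signedBoundaryDist Ω p : ℂ))) !₂[z, w]) :
    ‖dZ 1 (dZbar 0 (fun p => (signedBoundaryDist Ω p : ℂ))) !₂[z, w]‖ =
      1 / 4 * ‖(fderiv ℝ φ z 1 : ℂ) + Complex.I * (fderiv ℝ φ z Complex.I : ℂ)‖ := by
  obtain ⟨f, hfdef⟩ : ∃ f, f = dZbar 0 (fun p => (signedBoundaryDist Ω p : ℂ)) := ⟨_, rfl⟩
  obtain ⟨N, hN⟩ : ∃ N, N = complexNormal Ω w z := ⟨_, rfl⟩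
  have hN1 : ‖N‖ = 1 := hN ▸ h.norm_complexNormal ho hp hr hM
  have hNN : N * starRingEnd ℂ N = 1 := by
    rw [Complex.mul_conj, Complex.normSq_eq_norm_sq, hN1]; simp
  have hf := hM.self_of_nhds
  have hd := (h.hasFDerivAt_signedBoundaryDist ho hp hf hr).differentiableAt
  have hf0 : f !₂[z, w] = 0 := by
    rw [hfdef, dZbar_ofReal_comp, fderiv_single_zero_eq_zero hM hd,
      fderiv_single_zero_eq_zero hM hd]
    simp
  rw [← hfdef] at hfd ⊢
  obtain ⟨R, hR⟩ : ∃ R, R = ‖fderiv ℝ r !₂[z, w]‖ := ⟨_, rfl⟩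
  have hR0 : 0 < R := hR ▸ norm_pos_iff.2 hr
  -- normal direction
  have hnor := h.fderiv_dZbar_normal ho hp hf hr
    (n := EuclideanSpace.single 1 (starRingEnd ℂ N))
    (by rw [PiLp.norm_single, RCLike.norm_conj, hN1])
    (by rw [fderiv_single_one_eq_re, ← hN, hNN, Complex.one_re]) hfdef hfd hf0
  -- tangential direction
  set T : C2 := EuclideanSpace.single 1 (Complex.I * starRingEnd ℂ N) with hT
  have hDT : fderiv ℝ (signedBoundaryDist Ω) !₂[z, w] T = 0 := by
    rw [hT, fderiv_single_one_eq_re, ← hN, mul_left_comm, hNN, mul_one, Complex.I_re]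
  have hrT : fderiv ℝ r !₂[z, w] T = 0 := by
    rw [h.fderiv_eq_smul ho hp hf hr, smul_apply, hDT, smul_zero]
  have htan := h.fderiv_dZbar_tangential ho hp hf hr hrT hfdef hfd hf0
  have hsymm : IsSymmSndFDerivAt ℝ r !₂[z, w] :=
    (h.contDiffAt hp).isSymmSndFDerivAt (by
      rw [minSmoothness_of_isRCLikeNormedField]; exact WithTop.coe_le_coe.2 (le_top : (2 : ℕ∞) ≤ ⊤))
  have hsec : ∀ e : ℂ, fderiv ℝ (fderiv ℝ r) !₂[z, w] T (EuclideanSpace.single 0 e) =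
      - R * fderiv ℝ φ z e := by
    intro e
    -- Symmetry of the Hessian allows differentiating `fderiv ℝ r · T` along the slice instead.
    -- There it equals ‖Dr‖ Re(N(z') i N̄(z)) = -‖Dr‖ sin(φ(z') - φ(z)), a product whose second
    -- factor vanishes at z.
    rw [hsymm T]
    have hDr : HasFDerivAt (fderiv ℝ r) (fderiv ℝ (fderiv ℝ r) !₂[z, w]) !₂[z, w] :=
      ((h.contDiffAt_fderiv hp).differentiableAt (by simp)).hasFDerivAt
    have h1 := hDr.hasDerivAt_line_zero (v := EuclideanSpace.single 0 e)
    have h2 := (ContinuousLinearMap.apply ℝ ℝ T).hasFDerivAt.comp_hasDerivAt (0 : ℝ) h1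
    have h3 : HasDerivAt (fun x : ℝ => φ (z + x • e)) (fderiv ℝ φ z e) 0 :=
      hφd.hasFDerivAt.hasDerivAt_line_zero
    have h4 : HasDerivAt (fun x : ℝ => -Real.sin (φ (z + x • e) - φ z)) (-fderiv ℝ φ z e) 0 := by
      exact ((h3.sub_const (φ z)).sin).neg.congr_deriv (by simp)
    have h5 := h4.smul_of_eq_zero (R := fun x => ‖fderiv ℝ r !₂[z + x • e, w]‖) (by simp) (by
      simp only [← vec2_add_smul_single]
      exact (h1.continuousAt).norm)
    have hc : Tendsto (fun x : ℝ => z + x • e) (𝓝 0) (𝓝 z) := by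
      have : Continuous fun x : ℝ => z + x • e := by fun_prop
      simpa using this.tendsto 0
    have hreg := (continuous_slice w).continuousAt.eventually (h.eventually_regular hp hr)
    have h6 := h2.congr_of_eventuallyEq (f₁ := fun x : ℝ =>
      ‖fderiv ℝ r !₂[z + x • e, w]‖ • -Real.sin (φ (z + x • e) - φ z)) (by
      filter_upwards [hc.eventually (hM.and (hφ.and hreg))] with x hx
      obtain ⟨hx1, hx2, hx3, hx4⟩ := hx
      have hE : fderiv ℝ r !₂[z + x • e, w] T = ‖fderiv ℝ r !₂[z + x • e, w]‖ *
          fderiv ℝ (signedBoundaryDist Ω) !₂[z + x • e, w] T := by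
        conv_lhs => rw [h.fderiv_eq_smul ho hx3 hx1 hx4]
        rfl
      have hE2 : fderiv ℝ (signedBoundaryDist Ω) !₂[z + x • e, w] T =
          -Real.sin (φ (z + x • e) - φ z) := by
        rw [hT, fderiv_single_one_eq_re, hx2, hN, hφ.self_of_nhds, ← Complex.exp_conj]
        have : Complex.exp (φ (z + x • e) * Complex.I) *
            (Complex.I * Complex.exp (starRingEnd ℂ (φ z * Complex.I))) =
            Complex.I * Complex.exp (((φ (z + x • e) - φ z : ℝ) : ℂ) * Complex.I) := by
          rw [mul_left_comm, ← Complex.exp_add]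
          congr 2
          simp
          ring
        rw [this, Complex.I_mul_re, Complex.exp_ofReal_mul_I_im]
      simp only [Function.comp_apply, ContinuousLinearMap.apply_apply, vec2_add_smul_single]
      rw [hE, hE2, smul_eq_mul])
    have h7 := h6.unique h5
    simp only [ContinuousLinearMap.apply_apply] at h7
    rw [h7]
    simp [hR]
  rw [hsec, hsec, ← hR, Complex.real_smul] at htan
  obtain ⟨Q, hQ⟩ : ∃ Q : ℂ, Q = (fderiv ℝ φ z 1 : ℂ) + Complex.I * (fderiv ℝ φ z Complex.I : ℂ) :=
    ⟨_, rfl⟩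
  have hRc : (R : ℂ) ≠ 0 := by exact_mod_cast hR0.ne'
  have htan2 : fderiv ℝ f !₂[z, w] T = -(1 / 2) * Q := by
    apply mul_left_cancel₀ hRc
    rw [htan, hQ]; push_cast; ring
  rw [← hQ]
  -- recover the derivative from its values in two directions
  obtain ⟨F1, hF1⟩ : ∃ F, F = fderiv ℝ f !₂[z, w] (EuclideanSpace.single 1 1) := ⟨_, rfl⟩
  obtain ⟨FI, hFI⟩ : ∃ F, F = fderiv ℝ f !₂[z, w] (EuclideanSpace.single 1 Complex.I) := ⟨_, rfl⟩
  rw [clm_single_eq, ← hF1, ← hFI] at hnor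
  rw [hT, clm_single_eq, ← hF1, ← hFI] at htan2
  -- The left side is Df(n) - i Df(T) for the normal n = N̄ and the tangent T = iN̄, and Df(n) = 0.
  have hmain : starRingEnd ℂ N * (F1 - Complex.I * FI) = Complex.I * (1 / 2 * Q) := by
    have hcN : starRingEnd ℂ N = N.re - N.im * Complex.I := by
      apply Complex.ext <;> simp
    simp only [Complex.real_smul, Complex.conj_re, Complex.conj_im, Complex.mul_re, Complex.mul_im,
      Complex.I_re, Complex.I_im, zero_mul, one_mul, zero_sub, zero_add, neg_neg] at hnor htan2
    push_cast at hnor htan2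
    rw [hcN]
    linear_combination hnor - Complex.I * htan2 + FI * N.im * Complex.I_sq
  rw [dZ, ← hF1, ← hFI, norm_mul]
  have h8 := congrArg norm hmain
  rw [norm_mul, RCLike.norm_conj, hN1, one_mul, norm_mul, Complex.norm_I, one_mul, norm_mul] at h8
  rw [h8]
  norm_num
  ring

end IsLocalDefining

/-! ### Second-order calculus -/

/-- The derivative of the remainder at `y` is o(‖y‖); the mean value inequality on the ball of
radius `‖x‖` integrates this. -/
theorem taylor_two_remainder {E : Type*} [NormedAddCommGroup E] [NormedSpace ℝ E] {G : E → ℝ}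
    (hG : ContDiffAt ℝ 2 G 0) {c : ℝ} (hc : 0 < c) : ∀ᶠ x in 𝓝 (0 : E),
      |G x - G 0 - fderiv ℝ G 0 x - 1 / 2 * fderiv ℝ (fderiv ℝ G) 0 x x| ≤ c * ‖x‖ ^ 2 := by
  have hsymm : IsSymmSndFDerivAt ℝ G 0 := hG.isSymmSndFDerivAt (by simp)
  have hd2 : DifferentiableAt ℝ (fderiv ℝ G) 0 :=
    (hG.fderiv_right (m := 1) (by norm_num)).differentiableAt (by simp)
  set Q := fderiv ℝ (fderiv ℝ G) 0 with hQ
  have hd1 : ∀ᶠ x in 𝓝 (0 : E), DifferentiableAt ℝ G x := by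
    filter_upwards [hG.eventually (by simp)] with x hx
    exact hx.differentiableAt (by simp)
  have hlo := (hasFDerivAt_iff_isLittleO.1 hd2.hasFDerivAt).def hc
  obtain ⟨ρ, hρ, hball⟩ := Metric.eventually_nhds_iff.1 (hd1.and hlo)
  have hQd : ∀ x : E, HasFDerivAt (fun y => 1 / 2 * Q y y) (Q x) x := by
    intro x
    have h1 := (Q.hasFDerivAt (x := x)).clm_apply (hasFDerivAt_id x)
    refine (h1.const_mul (1 / 2 : ℝ)).congr_fderiv ?_
    ext v
    have := hsymm x v
    simp only [id_eq, ContinuousLinearMap.comp_id, smul_apply, add_apply,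
      ContinuousLinearMap.flip_apply, smul_eq_mul]
    linarith
  filter_upwards [Metric.ball_mem_nhds (0 : E) hρ] with x hx
  have hx' : ‖x‖ < ρ := by simpa using hx
  have hmv := (convex_closedBall (0 : E) ‖x‖).norm_image_sub_le_of_norm_hasFDerivWithin_le
    (f := fun y => G y - G 0 - fderiv ℝ G 0 y - 1 / 2 * Q y y)
    (f' := fun y => fderiv ℝ G y - fderiv ℝ G 0 - Q y) (C := c * ‖x‖)
    (fun y hy => by
      have hy' : ‖y‖ ≤ ‖x‖ := by simpa using hy
      have := (hball (y := y) (by rw [dist_zero_right]; linarith)).1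
      exact (((this.hasFDerivAt.sub_const (G 0)).sub (fderiv ℝ G 0).hasFDerivAt).sub
        (hQd y)).hasFDerivWithinAt)
    (fun y hy => by
      have hy' : ‖y‖ ≤ ‖x‖ := by simpa using hy
      have := (hball (y := y) (by rw [dist_zero_right]; linarith)).2
      rw [sub_zero] at this
      exact this.trans (by gcongr))
    (show (0 : E) ∈ _ by simp) (show x ∈ _ by simp)
  simpa [pow_two, mul_assoc] using hmv

theorem circleAverage_quadratic (L : ℂ →L[ℝ] ℝ) (Q : ℂ →L[ℝ] ℂ →L[ℝ] ℝ) (k ρ : ℝ) :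
    Real.circleAverage (fun ξ => k + L ξ + 1 / 2 * Q ξ ξ) 0 ρ =
      k + ρ ^ 2 / 4 * (Q 1 1 + Q Complex.I Complex.I) := by
  have hpt : ∀ θ : ℝ, k + L (circleMap 0 ρ θ) + 1 / 2 * Q (circleMap 0 ρ θ) (circleMap 0 ρ θ) =
      k + (ρ * L 1) * Real.cos θ + (ρ * L Complex.I) * Real.sin θ
      + (ρ ^ 2 / 2 * Q 1 1) * Real.cos θ ^ 2
      + (ρ ^ 2 / 2 * (Q 1 Complex.I + Q Complex.I 1)) * (Real.sin θ * Real.cos θ)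
      + (ρ ^ 2 / 2 * Q Complex.I Complex.I) * Real.sin θ ^ 2 := by
    intro θ
    have h1 : circleMap 0 ρ θ =
        (ρ * Real.cos θ) • (1 : ℂ) + (ρ * Real.sin θ) • Complex.I := by
      rw [circleMap_zero, Complex.exp_mul_I]
      simp only [Complex.real_smul, Complex.ofReal_mul, Complex.ofReal_cos, Complex.ofReal_sin]
      ring
    rw [h1]
    simp only [map_add, map_smul, add_apply, smul_apply, smul_eq_mul]
    ring
  rw [Real.circleAverage_def]
  simp only [hpt]
  have i0 : IntervalIntegrable (fun _ : ℝ => k) MeasureTheory.volume 0 (2 * Real.pi) :=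
    intervalIntegrable_const
  have i1 : IntervalIntegrable (fun θ => (ρ * L 1) * Real.cos θ) MeasureTheory.volume 0
    (2 * Real.pi) := (by fun_prop : Continuous _).intervalIntegrable _ _
  have i2 : IntervalIntegrable (fun θ => (ρ * L Complex.I) * Real.sin θ) MeasureTheory.volume 0
    (2 * Real.pi) := (by fun_prop : Continuous _).intervalIntegrable _ _
  have i3 : IntervalIntegrable (fun θ => (ρ ^ 2 / 2 * Q 1 1) * Real.cos θ ^ 2)
    MeasureTheory.volume 0 (2 * Real.pi) := (by fun_prop : Continuous _).intervalIntegrable _ _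
  have i4 : IntervalIntegrable (fun θ => (ρ ^ 2 / 2 * (Q 1 Complex.I + Q Complex.I 1)) *
    (Real.sin θ * Real.cos θ)) MeasureTheory.volume 0 (2 * Real.pi) :=
    (by fun_prop : Continuous _).intervalIntegrable _ _
  have i5 : IntervalIntegrable (fun θ => (ρ ^ 2 / 2 * Q Complex.I Complex.I) * Real.sin θ ^ 2)
    MeasureTheory.volume 0 (2 * Real.pi) := (by fun_prop : Continuous _).intervalIntegrable _ _
  rw [intervalIntegral.integral_add ((((i0.add i1).add i2).add i3).add i4) i5,
    intervalIntegral.integral_add (((i0.add i1).add i2).add i3) i4,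
    intervalIntegral.integral_add ((i0.add i1).add i2) i3,
    intervalIntegral.integral_add (i0.add i1) i2, intervalIntegral.integral_add i0 i1]
  simp only [intervalIntegral.integral_const_mul, intervalIntegral.integral_const, integral_cos,
    integral_sin, integral_cos_sq, integral_sin_sq, integral_sin_mul_cos₁, Real.sin_two_pi,
    Real.cos_two_pi, Real.sin_zero, Real.cos_zero, smul_eq_mul]
  have := Real.pi_ne_zero
  field_simp
  ring

/-- A twice differentiable function satisfying the sub-mean value inequality at the origin has
nonnegative Laplacian there. -/
theorem laplacian_nonneg_of_submean {G : ℂ → ℝ} (hG : ContDiffAt ℝ 2 G 0)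
    (hsub : ∀ᶠ ρ in 𝓝[>] (0 : ℝ), G 0 ≤ Real.circleAverage G 0 ρ) :
    0 ≤ fderiv ℝ (fderiv ℝ G) 0 1 1 + fderiv ℝ (fderiv ℝ G) 0 Complex.I Complex.I := by
  set Q := fderiv ℝ (fderiv ℝ G) 0
  refine le_of_forall_pos_le_add fun ε hε => ?_
  have hcont : ∀ᶠ x in 𝓝 (0 : ℂ), ContinuousAt G x := by
    filter_upwards [hG.eventually (by simp)] with x hx
    exact hx.continuousAt
  obtain ⟨δ, hδ, hball⟩ := Metric.eventually_nhds_iff.1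
    (hcont.and (taylor_two_remainder hG (show 0 < ε / 4 by positivity)))
  have hsm : ∀ᶠ ρ in 𝓝[>] (0 : ℝ), ρ < δ := nhdsWithin_le_nhds (eventually_lt_nhds hδ)
  obtain ⟨ρ, ⟨hs, hρδ⟩, hρ0⟩ := ((hsub.and hsm).and self_mem_nhdsWithin).exists
  have hρ0 : 0 < ρ := hρ0
  have hmem : ∀ x ∈ Metric.sphere (0 : ℂ) |ρ|, ‖x‖ = ρ := fun x hx => by
    rw [mem_sphere_zero_iff_norm, abs_of_pos hρ0] at hx; exact hx
  have hint : CircleIntegrable G 0 ρ := by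
    apply ContinuousOn.circleIntegrable'
    intro x hx
    exact (hball (y := x) (by rw [dist_zero_right, hmem x hx]; exact hρδ)).1.continuousWithinAt
  have hle := Real.circleAverage_mono (f₂ := fun ξ =>
      (G 0 + ε / 4 * ρ ^ 2) + fderiv ℝ G 0 ξ + 1 / 2 * Q ξ ξ) hint
    (by
      apply ContinuousOn.circleIntegrable'
      exact (by fun_prop : Continuous fun ξ : ℂ =>
        (G 0 + ε / 4 * ρ ^ 2) + fderiv ℝ G 0 ξ + 1 / 2 * Q ξ ξ).continuousOn)
    (fun x hx => by
      have h1 := (hball (y := x) (by rw [dist_zero_right, hmem x hx]; exact hρδ)).2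
      rw [hmem x hx] at h1
      have := (abs_le.1 h1).2
      linarith)
  rw [circleAverage_quadratic] at hle
  have h2 : 0 ≤ ρ ^ 2 / 4 * (Q 1 1 + Q Complex.I Complex.I + ε) := by linarith
  exact nonneg_of_mul_nonneg_right h2 (by positivity)

theorem fderiv_fderiv_apply_eq {E : Type*} [NormedAddCommGroup E] [NormedSpace ℝ E] {G : E → ℝ}
    (hG : ContDiffAt ℝ 2 G 0) {e : E} {g1 : ℝ → ℝ} {g2 : ℝ}
    (h1 : ∀ᶠ x in 𝓝 (0 : ℝ), HasDerivAt (fun x : ℝ => G (x • e)) (g1 x) x)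
    (h2 : HasDerivAt g1 g2 0) : fderiv ℝ (fderiv ℝ G) 0 e e = g2 := by
  have hd2 : DifferentiableAt ℝ (fderiv ℝ G) 0 :=
    (hG.fderiv_right (m := 1) (by norm_num)).differentiableAt (by simp)
  have hl : ∀ x : ℝ, HasDerivAt (fun x : ℝ => x • e) e x := fun x => by
    simpa using (hasDerivAt_id x).smul_const e
  have hd1 : ∀ᶠ x in 𝓝 (0 : ℝ), DifferentiableAt ℝ G (x • e) := by
    have h3 : ∀ᶠ y in 𝓝 ((0 : ℝ) • e), DifferentiableAt ℝ G y := by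
      rw [zero_smul]
      filter_upwards [hG.eventually (by simp)] with x hx
      exact hx.differentiableAt (by simp)
    exact (hl 0).continuousAt.eventually h3
  have h4 : HasDerivAt (fun x : ℝ => fderiv ℝ G (x • e) e) (fderiv ℝ (fderiv ℝ G) 0 e e) 0 := by
    have h5 : HasFDerivAt (fderiv ℝ G) (fderiv ℝ (fderiv ℝ G) 0) ((0 : ℝ) • e) := by
      rw [zero_smul]; exact hd2.hasFDerivAt
    exact (ContinuousLinearMap.apply ℝ ℝ e).hasFDerivAt.comp_hasDerivAt (0 : ℝ)
      (h5.comp_hasDerivAt (0 : ℝ) (hl 0))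
  refine h4.unique (h2.congr_of_eventuallyEq ?_)
  filter_upwards [h1, hd1] with x hx hdx
  exact (hdx.hasFDerivAt.comp_hasDerivAt x (hl x)).unique hx

/-! ### The comparison function and its Laplacian -/

theorem hasDerivAt_rpow_mul_rpow {K q : ℝ → ℝ} {K1 q1 x τ : ℝ} (hK : HasDerivAt K K1 x)
    (hq : HasDerivAt q q1 x) (hK0 : 0 < K x) (hq0 : 0 < q x) :
    HasDerivAt (fun x => K x ^ (1 - τ) * q x ^ τ)
      (K x ^ (1 - τ) * q x ^ τ * ((1 - τ) * (K1 / K x) + τ * (q1 / q x))) x := by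
  refine ((hK.rpow_const (p := 1 - τ) (Or.inl hK0.ne')).mul
    (hq.rpow_const (p := τ) (Or.inl hq0.ne'))).congr_deriv ?_
  rw [Real.rpow_sub_one hK0.ne', Real.rpow_sub_one hq0.ne']
  ring

/-- Since the exponents add up to 1, all first-order terms combine into one perfect square of the
difference of logarithmic derivatives. -/
theorem second_derivative_rpow_mul_rpow {K q K1 q1 : ℝ → ℝ} {K2 q2 τ : ℝ}
    (hK : ∀ᶠ x in 𝓝 (0 : ℝ), HasDerivAt K (K1 x) x) (hK1 : HasDerivAt K1 K2 0)
    (hq : ∀ᶠ x in 𝓝 (0 : ℝ), HasDerivAt q (q1 x) x) (hq1 : HasDerivAt q1 q2 0)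
    (hK0 : 0 < K 0) (hq0 : 0 < q 0) :
    ∃ g1 : ℝ → ℝ, (∀ᶠ x in 𝓝 (0 : ℝ), HasDerivAt (fun x => K x ^ (1 - τ) * q x ^ τ) (g1 x) x) ∧
      HasDerivAt g1 (K 0 ^ (1 - τ) * q 0 ^ τ * ((1 - τ) * (K2 / K 0) + τ * (q2 / q 0)
        + τ * (τ - 1) * (K1 0 / K 0 - q1 0 / q 0) ^ 2)) 0 := by
  refine ⟨fun x => K x ^ (1 - τ) * q x ^ τ * ((1 - τ) * (K1 x / K x) + τ * (q1 x / q x)), ?_, ?_⟩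
  · have h1 : ∀ᶠ x in 𝓝 (0 : ℝ), 0 < K x :=
      hK.self_of_nhds.continuousAt.eventually (eventually_gt_nhds hK0)
    have h2 : ∀ᶠ x in 𝓝 (0 : ℝ), 0 < q x :=
      hq.self_of_nhds.continuousAt.eventually (eventually_gt_nhds hq0)
    filter_upwards [hK, hq, h1, h2] with x a b c d
    exact hasDerivAt_rpow_mul_rpow a b c d
  · have hKd := hK.self_of_nhds
    have hqd := hq.self_of_nhds
    refine ((hasDerivAt_rpow_mul_rpow (τ := τ) hKd hqd hK0 hq0).mul
      (((hK1.div hKd hK0.ne').const_mul (1 - τ)).add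
        ((hq1.div hqd hq0.ne').const_mul τ))).congr_deriv ?_
    simp only [Pi.add_apply, Pi.div_apply]
    field_simp
    ring

/-- Second derivative along a line of the comparison function `K^(1-τ) q^τ`. -/
theorem comparison_second_derivative {f f1 : ℝ → ℝ} {f2 κ k τ m s t : ℝ} {ζ v : ℂ}
    (hf : ∀ᶠ x in 𝓝 (0 : ℝ), HasDerivAt f (f1 x) x) (hf1 : HasDerivAt f1 f2 0)
    (hζ : Complex.exp (f 0 * Complex.I) * ζ = 1 + m * Complex.I)
    (hv : Complex.exp (f 0 * Complex.I) * v = s + t * Complex.I)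
    {p S : ℝ} (hS : S = Real.sin (κ * (f 0 - k))) (hS0 : 0 < S)
    (hp : p = κ * Real.cos (κ * (f 0 - k)) / S) :
    ∃ g1 : ℝ → ℝ, (∀ᶠ x in 𝓝 (0 : ℝ), HasDerivAt (fun x : ℝ => Real.sin (κ * (f x - k)) ^ (1 - τ) *
        (Complex.exp (f x * Complex.I) * (ζ + x * v)).re ^ τ) (g1 x) x) ∧
      HasDerivAt g1 (S ^ (1 - τ) * ((1 - τ) * (p * f2 - κ ^ 2 * f1 0 ^ 2)
        + τ * (-m * f2 - f1 0 ^ 2 - 2 * f1 0 * t)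
        + τ * (τ - 1) * (p * f1 0 - (-f1 0 * m + s)) ^ 2)) 0 := by
  have hK : ∀ᶠ x in 𝓝 (0 : ℝ), HasDerivAt (fun x => Real.sin (κ * (f x - k)))
      (Real.cos (κ * (f x - k)) * (κ * f1 x)) x := by
    filter_upwards [hf] with x hx
    exact ((hx.sub_const k).const_mul κ).sin
  have hK1 : HasDerivAt (fun x => Real.cos (κ * (f x - k)) * (κ * f1 x)) _ 0 :=
    ((hf.self_of_nhds.sub_const k).const_mul κ).cos.mul (hf1.const_mul κ)
  have hE : ∀ {x : ℝ}, HasDerivAt f (f1 x) x → HasDerivAt (fun x : ℝ => Complex.exp (f x * Complex.I))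
      (Complex.exp (f x * Complex.I) * (f1 x * Complex.I)) x := fun {x} hx =>
    (hx.ofReal_comp.mul_const Complex.I).cexp
  have hlin : ∀ x : ℝ, HasDerivAt (fun x : ℝ => ζ + x * v) v x := fun x => by
    simpa using ((hasDerivAt_id x).ofReal_comp.mul_const v).const_add ζ
  have hre : ∀ {F : ℝ → ℂ} {F' : ℂ} {x : ℝ}, HasDerivAt F F' x →
      HasDerivAt (fun x => (F x).re) F'.re x := fun {F F' x} hF =>
    Complex.reCLM.hasFDerivAt.comp_hasDerivAt x hF
  have hq : ∀ᶠ x in 𝓝 (0 : ℝ), HasDerivAt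
      (fun x : ℝ => (Complex.exp (f x * Complex.I) * (ζ + x * v)).re)
      (Complex.exp (f x * Complex.I) * (f1 x * Complex.I) * (ζ + x * v) +
        Complex.exp (f x * Complex.I) * v).re x := by
    filter_upwards [hf] with x hx
    exact hre ((hE hx).mul (hlin x))
  have hE0 := hE hf.self_of_nhds
  have hq1 : HasDerivAt (fun x : ℝ => (Complex.exp (f x * Complex.I) * (f1 x * Complex.I) *
      (ζ + x * v) + Complex.exp (f x * Complex.I) * v).re)
      ((Complex.exp (f 0 * Complex.I) * (f1 0 * Complex.I) * (f1 0 * Complex.I) +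
        Complex.exp (f 0 * Complex.I) * (f2 * Complex.I)) * (ζ + (0 : ℝ) * v) +
        Complex.exp (f 0 * Complex.I) * (f1 0 * Complex.I) * v +
        Complex.exp (f 0 * Complex.I) * (f1 0 * Complex.I) * v).re 0 :=
    hre (((hE0.mul (hf1.ofReal_comp.mul_const Complex.I)).mul (hlin 0)).add (hE0.mul_const v))
  set N := Complex.exp (f 0 * Complex.I) with hN
  have hq0 : (N * (ζ + (0 : ℝ) * v)).re = 1 := by
    simp [hζ]
  have hq10 : (N * (f1 0 * Complex.I) * (ζ + (0 : ℝ) * v) + N * v).re = -f1 0 * m + s := by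
    have : N * (f1 0 * Complex.I) * (ζ + (0 : ℝ) * v) + N * v =
        f1 0 * Complex.I * (N * ζ) + N * v := by push_cast; ring
    rw [this, hζ, hv]
    simp
  obtain ⟨g1, hg1, hg2⟩ := second_derivative_rpow_mul_rpow (τ := τ) hK hK1 hq hq1
    (by rw [← hS]; exact hS0) (by rw [hq0]; exact one_pos)
  refine ⟨g1, hg1, hg2.congr_deriv ?_⟩
  rw [hq0, hq10, ← hS, Real.one_rpow, mul_one]
  congr 1
  have hq2 : ((N * (f1 0 * Complex.I) * (f1 0 * Complex.I) + N * (f2 * Complex.I)) *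
      (ζ + (0 : ℝ) * v) + N * (f1 0 * Complex.I) * v + N * (f1 0 * Complex.I) * v).re =
      -m * f2 - f1 0 ^ 2 - 2 * f1 0 * t := by
    have : (N * (f1 0 * Complex.I) * (f1 0 * Complex.I) + N * (f2 * Complex.I)) *
      (ζ + (0 : ℝ) * v) + N * (f1 0 * Complex.I) * v + N * (f1 0 * Complex.I) * v =
      (-(f1 0) ^ 2 + f2 * Complex.I) * (N * ζ) + 2 * f1 0 * Complex.I * (N * v) := by
      push_cast
      linear_combination (f1 0 : ℂ) ^ 2 * N * ζ * Complex.I_sq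
    rw [this, hζ, hv]
    simp [pow_two]
    ring
  rw [hq2]
  have hp' : κ * Real.cos (κ * (f 0 - k)) = p * S := by rw [hp]; field_simp
  have e1 : (-S * (κ * f1 0) * (κ * f1 0) +
      Real.cos (κ * (f 0 - k)) * (κ * f2)) / S = p * f2 - κ ^ 2 * f1 0 ^ 2 := by
    rw [div_eq_iff hS0.ne']
    linear_combination f2 * hp'
  have e2 : Real.cos (κ * (f 0 - k)) * (κ * f1 0) / S = p * f1 0 := by
    rw [div_eq_iff hS0.ne']
    linear_combination f1 0 * hp'
  rw [e1, e2]
  ring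

/-- At a point where the phase `φ` is not critical, the comparison function
`sin(κ (φ - k))^(1-τ) (Re (e^{iφ} ζ))^τ` with `|κ| < τ / (τ - 1)` violates the sub-mean value
inequality along some complex line. -/
theorem exists_not_submean_comparison {φ : ℂ → ℝ} {z : ℂ} (hφ : ContDiffAt ℝ 2 φ z)
    (hgrad : fderiv ℝ φ z 1 ≠ 0 ∨ fderiv ℝ φ z Complex.I ≠ 0) {κ k τ : ℝ} (hτ : 1 < τ)
    (hκ : κ ^ 2 < (τ / (τ - 1)) ^ 2) (hS : 0 < Real.sin (κ * (φ z - k))) :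
    ∃ ζ b : ℂ, (Complex.exp (φ z * Complex.I) * ζ).re = 1 ∧ ∀ G : ℂ → ℝ,
      (G = fun ξ => Real.sin (κ * (φ (z + ξ) - k)) ^ (1 - τ) *
        (Complex.exp (φ (z + ξ) * Complex.I) * (ζ + ξ * b)).re ^ τ) →
      ¬ ∀ᶠ ρ in 𝓝[>] (0 : ℝ), G 0 ≤ Real.circleAverage G 0 ρ := by
  obtain ⟨a, ha⟩ : ∃ a, a = fderiv ℝ φ z 1 := ⟨_, rfl⟩
  obtain ⟨d, hd⟩ : ∃ d, d = fderiv ℝ φ z Complex.I := ⟨_, rfl⟩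
  obtain ⟨S, hSdef⟩ : ∃ S, S = Real.sin (κ * (φ z - k)) := ⟨_, rfl⟩
  obtain ⟨p, hp⟩ : ∃ p, p = κ * Real.cos (κ * (φ z - k)) / S := ⟨_, rfl⟩
  -- The choice of `m` makes the coefficient (1-τ)p - τm of the Laplacian of φ vanish. The Laplacian
  -- of `G` is then quadratic in `(b1, b2)`, and these values minimise it. Up to the factor S^(1-τ)
  -- the minimum is |∇φ|² ((τ-1)κ² - τ - τγ), where τ + τγ = τ²/(τ-1), so it is negative exactly
  -- when |κ| < τ/(τ-1).
  obtain ⟨γ, hγ⟩ : ∃ γ, γ = 1 / (τ - 1) := ⟨_, rfl⟩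
  obtain ⟨m, hm⟩ : ∃ m, m = -((τ - 1) * p / τ) := ⟨_, rfl⟩
  obtain ⟨b1, hb1⟩ : ∃ b1, b1 = a * m + p * a + γ * d := ⟨_, rfl⟩
  obtain ⟨b2, hb2⟩ : ∃ b2, b2 = -d * m - p * d + γ * a := ⟨_, rfl⟩
  rw [← hSdef] at hS
  have hτ0 : 0 < τ := by linarith
  have hτ1 : 0 < τ - 1 := by linarith
  set N := Complex.exp (φ z * Complex.I) with hN
  have hN0 : N ≠ 0 := Complex.exp_ne_zero _
  have hζ : N * (N⁻¹ * (1 + m * Complex.I)) = 1 + m * Complex.I := mul_inv_cancel_left₀ hN0 _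
  have hb : N * (N⁻¹ * (b1 + b2 * Complex.I)) = b1 + b2 * Complex.I := mul_inv_cancel_left₀ hN0 _
  refine ⟨N⁻¹ * (1 + m * Complex.I), N⁻¹ * (b1 + b2 * Complex.I), by rw [hζ]; simp,
    fun G hG hsub => ?_⟩
  set ζ := N⁻¹ * (1 + m * Complex.I)
  set b := N⁻¹ * (b1 + b2 * Complex.I)
  have hφ' : ContDiffAt ℝ 2 (fun ξ => φ (z + ξ)) 0 := by
    have : ContDiffAt ℝ 2 φ (z + 0) := by rwa [add_zero]
    exact this.comp (0 : ℂ) (by fun_prop)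
  have hGc : ContDiffAt ℝ 2 G 0 := by
    rw [hG]
    refine ContDiffAt.mul ?_ ?_
    · refine ContDiffAt.rpow_const_of_ne ?_ ?_
      · exact (contDiffAt_const.mul (hφ'.sub contDiffAt_const)).sin
      · rw [add_zero, ← hSdef]; exact hS.ne'
    · refine ContDiffAt.rpow_const_of_ne ?_ ?_
      · have h1 : ContDiffAt ℝ 2 (fun ξ => Complex.exp (φ (z + ξ) * Complex.I) * (ζ + ξ * b)) 0 :=
          ((Complex.ofRealCLM.contDiff.contDiffAt.comp (0 : ℂ) hφ').mul
            contDiffAt_const).cexp.mul (by fun_prop)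
        exact Complex.reCLM.contDiff.contDiffAt.comp (0 : ℂ) h1
      · rw [add_zero, zero_mul, add_zero, ← hN, hζ]; simp
  have hlap := laplacian_nonneg_of_submean hGc hsub
  -- derivatives of the phase along a line
  have hd2 : DifferentiableAt ℝ (fderiv ℝ φ) z :=
    (hφ.fderiv_right (m := 1) (by norm_num)).differentiableAt (by simp)
  have hline : ∀ e : ℂ, (∀ᶠ x in 𝓝 (0 : ℝ), HasDerivAt (fun x : ℝ => φ (z + x • e))
      (fderiv ℝ φ (z + x • e) e) x) ∧
      HasDerivAt (fun x : ℝ => fderiv ℝ φ (z + x • e) e) (fderiv ℝ (fderiv ℝ φ) z e e) 0 := by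
    intro e
    constructor
    · have h1 : ∀ᶠ y in 𝓝 z, DifferentiableAt ℝ φ y := by
        filter_upwards [hφ.eventually (by simp)] with y hy
        exact hy.differentiableAt (by simp)
      have hc : Tendsto (fun x : ℝ => z + x • e) (𝓝 0) (𝓝 z) := by
        have : Continuous fun x : ℝ => z + x • e := by fun_prop
        simpa using this.tendsto 0
      filter_upwards [hc.eventually h1] with x hx
      exact hx.hasFDerivAt.hasDerivAt_line
    · exact (ContinuousLinearMap.apply ℝ ℝ e).hasFDerivAt.comp_hasDerivAt (0 : ℝ)
        hd2.hasFDerivAt.hasDerivAt_line_zero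
  have hsecond : ∀ (e : ℂ) (s t : ℝ), N * (e * b) = s + t * Complex.I →
      fderiv ℝ (fderiv ℝ G) 0 e e = S ^ (1 - τ) * ((1 - τ) *
        (p * fderiv ℝ (fderiv ℝ φ) z e e - κ ^ 2 * fderiv ℝ φ z e ^ 2)
        + τ * (-m * fderiv ℝ (fderiv ℝ φ) z e e - fderiv ℝ φ z e ^ 2 - 2 * fderiv ℝ φ z e * t)
        + τ * (τ - 1) * (p * fderiv ℝ φ z e - (-fderiv ℝ φ z e * m + s)) ^ 2) := by
    intro e s t hv
    obtain ⟨h1, h2⟩ := hline e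
    obtain ⟨g1, hg1, hg2⟩ := comparison_second_derivative (κ := κ) (k := k) (τ := τ) (m := m)
      (s := s) (t := t) (ζ := ζ) (v := e * b) (p := p) (S := S) h1 h2
      (by simpa using hζ) (by simpa using hv) (by simpa using hSdef) hS (by simpa using hp)
    simp only [zero_smul, add_zero] at hg2
    refine fderiv_fderiv_apply_eq hGc ?_ hg2
    filter_upwards [hg1] with x hx
    rw [hG]
    simpa only [Complex.real_smul, mul_assoc] using hx
  rw [hsecond 1 b1 b2 (by rw [one_mul, hb]),
    hsecond Complex.I (-b2) b1 (by
      rw [mul_left_comm, hb]; push_cast; linear_combination (b2 : ℂ) * Complex.I_sq),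
    ← ha, ← hd, ← mul_add] at hlap
  have hlap2 := nonneg_of_mul_nonneg_right hlap (Real.rpow_pos_of_pos hS _)
  set X1 := fderiv ℝ (fderiv ℝ φ) z 1 1
  set X2 := fderiv ℝ (fderiv ℝ φ) z Complex.I Complex.I
  have had : 0 < a ^ 2 + d ^ 2 := by
    rw [← ha, ← hd] at hgrad
    rcases hgrad with h | h <;> positivity
  have hmτ : τ * m = -((τ - 1) * p) := by rw [hm]; field_simp
  have hγτ : (τ - 1) * γ = 1 := by rw [hγ]; field_simp
  have hκ2 : (τ - 1) ^ 2 * κ ^ 2 < τ ^ 2 := by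
    rw [div_pow, lt_div_iff₀ (by positivity)] at hκ; linarith
  have hkey : (τ - 1) * κ ^ 2 - τ - τ * γ < 0 := by
    have : (τ - 1) * ((τ - 1) * κ ^ 2 - τ - τ * γ) < 0 := by
      have : (τ - 1) * ((τ - 1) * κ ^ 2 - τ - τ * γ) = (τ - 1) ^ 2 * κ ^ 2 - τ ^ 2 := by
        linear_combination (-τ) * hγτ
      linarith
    exact neg_of_mul_neg_right this hτ1.le
  have hfin : (a ^ 2 + d ^ 2) * ((τ - 1) * κ ^ 2 - τ - τ * γ) < 0 := mul_neg_of_pos_of_neg had hkey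
  refine absurd hlap2 (not_le.2 (lt_of_eq_of_lt ?_ hfin))
  rw [hb1, hb2]
  linear_combination (-(X1 + X2)) * hmτ + (τ * γ * (a ^ 2 + d ^ 2)) * hγτ

/-! ### Blow-up along the boundary slice -/

/-- Points displaced from a horizontal slice of the boundary in an outward direction are
exterior. -/
theorem IsLocalDefining.eventually_notMem_closure {Ω V : Set C2} {r : C2 → ℝ} {w z ζ : ℂ}
    (h : IsLocalDefining Ω V r) (ho : IsOpen Ω) (hp : !₂[z, w] ∈ V)
    (hr : fderiv ℝ r !₂[z, w] ≠ 0) (hM : ∀ᶠ z' in 𝓝 z, !₂[z', w] ∈ frontier Ω)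
    (hζ : 0 < (complexNormal Ω w z * ζ).re) :
    ∀ᶠ x : (ℂ × ℂ) × ℝ in 𝓝 ((z, ζ), 0), 0 < x.2 → !₂[x.1.1, w + x.2 * x.1.2] ∉ closure Ω := by
  set η := (complexNormal Ω w z * ζ).re / 2 with hη
  have hη0 : 0 < η := by positivity
  set R := ‖fderiv ℝ r !₂[z, w]‖ with hR
  have hR0 : 0 < R := norm_pos_iff.2 hr
  have hslice : Continuous fun x : (ℂ × ℂ) × ℝ => (!₂[x.1.1, w + x.2 * x.1.2] : C2) :=
    continuous_blowup w
  have hslice0 : Continuous fun x : (ℂ × ℂ) × ℝ => (!₂[x.1.1, w] : C2) :=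
    (continuous_slice w).comp (by fun_prop)
  have ht : Tendsto (fun x : (ℂ × ℂ) × ℝ => (!₂[x.1.1, w + x.2 * x.1.2], !₂[x.1.1, w]))
      (𝓝 ((z, ζ), 0)) (𝓝 ((!₂[z, w] : C2), (!₂[z, w] : C2))) := by
    have := (hslice.prodMk hslice0).tendsto ((z, ζ), (0 : ℝ))
    simpa using this
  -- With this constant the linearisation error is at most ε R η / 2, against a first-order growth
  -- of more than ε R η, for the displacement parameter ε = `x.2`. The estimate holds for all nearby
  -- base points and directions, as the compactness argument for whole discs requires.
  have hc0 : 0 < R * η / (2 * (‖ζ‖ + 1)) := by positivity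
  have h1 := ht.eventually ((h.hasStrictFDerivAt hp).isLittleO.def hc0)
  have h2 := ht.eventually ((h.isOpen.prod h.isOpen).eventually_mem
    (show ((!₂[z, w] : C2), (!₂[z, w] : C2)) ∈ V ×ˢ V from ⟨hp, hp⟩))
  have h3 : ∀ᶠ x : (ℂ × ℂ) × ℝ in 𝓝 ((z, ζ), 0), !₂[x.1.1, w] ∈ frontier Ω :=
    ((by fun_prop : Continuous fun x : (ℂ × ℂ) × ℝ => x.1.1).tendsto ((z, ζ), (0 : ℝ))).eventually
      hM
  have h4 : ∀ᶠ x : (ℂ × ℂ) × ℝ in 𝓝 ((z, ζ), 0), η < (complexNormal Ω w z * x.1.2).re :=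
    ((by fun_prop : Continuous fun x : (ℂ × ℂ) × ℝ =>
      (complexNormal Ω w z * x.1.2).re).tendsto ((z, ζ), (0 : ℝ))).eventually
      (eventually_gt_nhds (by simp only [hη]; linarith))
  have h5 : ∀ᶠ x : (ℂ × ℂ) × ℝ in 𝓝 ((z, ζ), 0), ‖x.1.2‖ < ‖ζ‖ + 1 :=
    ((by fun_prop : Continuous fun x : (ℂ × ℂ) × ℝ => ‖x.1.2‖).tendsto
      ((z, ζ), (0 : ℝ))).eventually (eventually_lt_nhds (by simp))
  filter_upwards [h1, h2, h3, h4, h5] with x h1 h2 h3 h4 h5 hx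
  refine h.notMem_closure h2.1 ?_
  have hdiff : (!₂[x.1.1, w + x.2 * x.1.2] - !₂[x.1.1, w] : C2) =
      x.2 • EuclideanSpace.single 1 x.1.2 := by
    ext i; fin_cases i <;> simp
  rw [hdiff, h.eq_zero h2.2 h3 ho, sub_zero, map_smul, norm_smul, PiLp.norm_single,
    h.fderiv_eq_smul ho hp hM.self_of_nhds hr, smul_apply, fderiv_single_one_eq_re, ← hR,
    Real.norm_eq_abs, Real.norm_eq_abs, abs_of_pos hx, smul_eq_mul, smul_eq_mul] at h1
  have h6 := (abs_le.1 h1).1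
  have h7 : R * η / (2 * (‖ζ‖ + 1)) * (x.2 * ‖x.1.2‖) ≤ x.2 * (R * η / 2) := by
    have : R * η / (2 * (‖ζ‖ + 1)) * (x.2 * ‖x.1.2‖) ≤
        R * η / (2 * (‖ζ‖ + 1)) * (x.2 * (‖ζ‖ + 1)) := by gcongr
    refine this.trans_eq ?_
    have : ‖ζ‖ + 1 ≠ 0 := by positivity
    field_simp
  have h8 : x.2 * (R * η) < x.2 * (R * (complexNormal Ω w z * x.1.2).re) := by gcongr
  have h9 : 0 < x.2 * (R * η) := by positivity
  linarith

/-- Rescaled signed distances converge to the linear function given by the complex normal. -/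
theorem tendsto_signedBoundaryDist_div {Ω : Set C2} {w z ζ : ℂ} (hf : !₂[z, w] ∈ frontier Ω)
    (hd : DifferentiableAt ℝ (signedBoundaryDist Ω) !₂[z, w]) :
    Tendsto (fun ε : ℝ => signedBoundaryDist Ω !₂[z, w + ε * ζ] / ε) (𝓝[>] 0)
      (𝓝 (complexNormal Ω w z * ζ).re) := by
  have h1 := hd.hasFDerivAt.hasDerivAt_line_zero (v := EuclideanSpace.single 1 ζ)
  rw [fderiv_single_one_eq_re] at h1
  have h2 := (hasDerivAt_iff_tendsto_slope.1 h1).mono_left (nhdsGT_le_nhdsNE (0 : ℝ))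
  refine h2.congr fun ε => ?_
  have h3 : (!₂[z, w] + ε • EuclideanSpace.single (1 : Fin 2) ζ : C2) = !₂[z, w + ε * ζ] := by
    ext i; fin_cases i <;> simp
  rw [slope_def_field, h3, zero_smul, add_zero, signedBoundaryDist_frontier hf, sub_zero, sub_zero]

theorem abs_signedBoundaryDist_blowup_le {Ω : Set C2} {w z ζ : ℂ} (hf : !₂[z, w] ∈ frontier Ω)
    {ε : ℝ} (hε : 0 < ε) : |signedBoundaryDist Ω !₂[z, w + ε * ζ] / ε| ≤ ‖ζ‖ := by
  have h1 := abs_signedBoundaryDist_le hf !₂[z, w + ε * ζ]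
  have h2 : (!₂[z, w + ε * ζ] - !₂[z, w] : C2) = EuclideanSpace.single 1 (ε * ζ) := by
    ext i; fin_cases i <;> simp
  rw [h2, PiLp.norm_single, norm_mul, Complex.norm_real, Real.norm_eq_abs] at h1
  rw [abs_div, div_le_iff₀ (abs_pos.2 hε.ne')]
  linarith

/-- The blow-up of `h δ^τ` along a horizontal slice of the boundary satisfies the sub-mean value
inequality on complex lines. -/
theorem submean_blowup {Ω : Set C2} (ho : IsOpen Ω) (hbd : HasSmoothBoundary Ω) {w z ζ b : ℂ}
    {U : Set C2} (hU : IsOpen U) (hΩU : closure Ω ⊆ U) {h : C2 → ℝ} (hh : ContinuousOn h U)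
    {τ : ℝ} (hτ : 0 < τ)
    (hpsh : PlurisubharmonicOn (fun p => h p * signedBoundaryDist Ω p ^ τ) (U \ closure Ω))
    {ρ : ℝ} (hM : ∀ ξ : ℂ, ‖ξ‖ ≤ 1 → ∀ᶠ z' in 𝓝 (z + ξ * ρ), !₂[z', w] ∈ frontier Ω)
    (hpos : ∀ ξ : ℂ, ‖ξ‖ ≤ 1 → 0 < (complexNormal Ω w (z + ξ * ρ) * (ζ + ξ * ρ * b)).re) :
    h !₂[z, w] * (complexNormal Ω w z * ζ).re ^ τ ≤
      Real.circleAverage (fun ξ => h !₂[z + ξ, w] *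
        (complexNormal Ω w (z + ξ) * (ζ + ξ * b)).re ^ τ) 0 ρ := by
  have hfr : ∀ ξ : ℂ, ‖ξ‖ ≤ 1 → !₂[z + ξ * ρ, w] ∈ frontier Ω := fun ξ hξ => (hM ξ hξ).self_of_nhds
  have hinU : ∀ ξ : ℂ, ‖ξ‖ ≤ 1 → !₂[z + ξ * ρ, w] ∈ U := fun ξ hξ =>
    hΩU (frontier_subset_closure (hfr ξ hξ))
  have hd : ∀ ξ : ℂ, ‖ξ‖ ≤ 1 → DifferentiableAt ℝ (signedBoundaryDist Ω) !₂[z + ξ * ρ, w] := by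
    intro ξ hξ
    obtain ⟨V, r, hV, hp, hr, hmem, hr0⟩ := hbd _ (hfr ξ hξ)
    exact (IsLocalDefining.hasFDerivAt_signedBoundaryDist ⟨hV, hr, hmem⟩ ho hp (hfr ξ hξ)
      hr0).differentiableAt
  -- the discs `ξ ↦ (z + ξ ρ, w + ε (ζ + ξ ρ b))`
  set P : ℝ → ℂ → C2 := fun ε ξ => !₂[z + ξ * ρ, w + ε * (ζ + ξ * ρ * b)] with hP
  have hPc : ∀ ξ, Tendsto (fun x : ℝ × ℂ => P x.1 x.2) (𝓝 (0, ξ)) (𝓝 !₂[z + ξ * ρ, w]) := by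
    intro ξ
    have h1 : Continuous fun x : ℝ × ℂ => P x.1 x.2 :=
      (continuous_blowup w).comp
        (by fun_prop : Continuous fun x : ℝ × ℂ => ((z + x.2 * ρ, ζ + x.2 * ρ * b), x.1))
    have := h1.tendsto (0, ξ)
    simpa [hP] using this
  have hcomp : IsCompact (Metric.closedBall (0 : ℂ) 1) := isCompact_closedBall 0 1
  obtain ⟨H, hH⟩ : ∃ H : ℝ, ∀ ξ : ℂ, ‖ξ‖ ≤ 1 → |h !₂[z + ξ * ρ, w]| < H := by
    have hc : ContinuousOn (fun ξ : ℂ => h !₂[z + ξ * ρ, w]) (Metric.closedBall (0 : ℂ) 1) :=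
      hh.comp ((continuous_slice w).comp (by fun_prop)).continuousOn
        fun ξ hξ => hinU ξ (by simpa using hξ)
    obtain ⟨H, hH⟩ := hcomp.exists_bound_of_continuousOn hc
    exact ⟨H + 1, fun ξ hξ => by
      have := hH ξ (by simpa using hξ)
      rw [Real.norm_eq_abs] at this
      linarith⟩
  -- By compactness of the closed disc, one threshold for `ε` serves all `ξ`: the whole disc lies in
  -- `U \ closure Ω`, with `h` bounded on it.
  have hev : ∀ᶠ ε in 𝓝 (0 : ℝ), ∀ ξ ∈ Metric.closedBall (0 : ℂ) 1,
      (P ε ξ ∈ U ∧ |h (P ε ξ)| < H) ∧ (0 < ε → P ε ξ ∉ closure Ω) := by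
    refine hcomp.eventually_forall_of_forall_eventually fun ξ hξ => ?_
    have hξ : ‖ξ‖ ≤ 1 := by simpa using hξ
    have h1 : ∀ᶠ y in 𝓝 (!₂[z + ξ * ρ, w] : C2), y ∈ U ∧ |h y| < H := by
      refine (hU.eventually_mem (hinU ξ hξ)).and ?_
      exact ((hh.continuousAt (hU.mem_nhds (hinU ξ hξ))).abs).eventually
        (eventually_lt_nhds (hH ξ hξ))
    refine ((hPc ξ).eventually h1).and ?_
    obtain ⟨V, r, hV, hp, hr, hmem, hr0⟩ := hbd _ (hfr ξ hξ)
    have h2 := IsLocalDefining.eventually_notMem_closure ⟨hV, hr, hmem⟩ ho hp hr0 (hM ξ hξ)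
      (hpos ξ hξ)
    exact ((by fun_prop : Continuous fun x : ℝ × ℂ =>
      ((z + x.2 * ρ, ζ + x.2 * ρ * b), x.1)).tendsto (0, ξ)).eventually h2
  set F : ℝ → ℂ → ℝ := fun ε ξ => h (P ε ξ) * (signedBoundaryDist Ω (P ε ξ) / ε) ^ τ with hF
  have hsub : ∀ᶠ ε in 𝓝[>] (0 : ℝ), CircleIntegrable (F ε) 0 1 ∧
      F ε 0 ≤ Real.circleAverage (F ε) 0 1 := by
    filter_upwards [nhdsWithin_le_nhds hev, self_mem_nhdsWithin] with ε hε hε0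
    have hε0 : 0 < ε := hε0
    have hline : ∀ ξ : ℂ, !₂[z, w + ε * ζ] + ξ • !₂[(ρ : ℂ), ε * (ρ * b)] = P ε ξ := by
      intro ξ
      ext i; fin_cases i
      · simp [hP]
      · simp [hP]; ring
    obtain ⟨h1, h2⟩ := hpsh.2 !₂[z, w + ε * ζ] !₂[(ρ : ℂ), ε * (ρ * b)] (fun ξ hξ => by
      rw [hline]
      have := hε ξ (by simpa using hξ)
      exact ⟨this.1.1, this.2 hε0⟩)
    simp only [hline] at h1 h2
    have hFe : ∀ ξ : ℂ, ‖ξ‖ ≤ 1 → F ε ξ =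
        (ε ^ τ)⁻¹ • (h (P ε ξ) * signedBoundaryDist Ω (P ε ξ) ^ τ) := by
      intro ξ hξ
      have hn : P ε ξ ∉ Ω := fun hm => (hε ξ (by simpa using hξ)).2 hε0 (subset_closure hm)
      simp only [hF]
      rw [Real.div_rpow (signedBoundaryDist_nonneg hn) hε0.le, smul_eq_mul]
      field_simp
    have hEq : Set.EqOn (F ε) (fun ξ => (ε ^ τ)⁻¹ •
        (h (P ε ξ) * signedBoundaryDist Ω (P ε ξ) ^ τ)) (Metric.sphere 0 |1|) := fun ξ hξ => by
      refine hFe ξ ?_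
      rw [mem_sphere_zero_iff_norm] at hξ
      rw [hξ]; simp
    constructor
    · exact (CircleIntegrable.const_fun_smul (a := (ε ^ τ)⁻¹) h1).congr
        (fun θ _ => (hEq (circleMap_mem_sphere' 0 1 θ)).symm)
    · rw [Real.circleAverage_congr_sphere hEq, Real.circleAverage_fun_smul, hFe 0 (by simp)]
      have hP0 : P ε 0 = !₂[z, w + ε * ζ] := by simp [hP]
      rw [hP0, smul_eq_mul, smul_eq_mul]
      exact mul_le_mul_of_nonneg_left h2 (by positivity)
  -- passage to the limit
  have hlim : ∀ ξ : ℂ, ‖ξ‖ ≤ 1 → Tendsto (fun ε => F ε ξ) (𝓝[>] 0) (𝓝 (h !₂[z + ξ * ρ, w] *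
      (complexNormal Ω w (z + ξ * ρ) * (ζ + ξ * ρ * b)).re ^ τ)) := by
    intro ξ hξ
    have h1 : Tendsto (fun ε : ℝ => P ε ξ) (𝓝[>] 0) (𝓝 !₂[z + ξ * ρ, w]) :=
      ((hPc ξ).comp ((by fun_prop : Continuous fun ε : ℝ => (ε, ξ)).tendsto 0)).mono_left
        nhdsWithin_le_nhds
    have h2 := (hh.continuousAt (hU.mem_nhds (hinU ξ hξ))).tendsto.comp h1
    exact h2.mul ((tendsto_signedBoundaryDist_div (hfr ξ hξ) (hd ξ hξ)).rpow_const
      (Or.inr hτ.le))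
  have havg : Tendsto (fun ε => Real.circleAverage (F ε) 0 1) (𝓝[>] 0)
      (𝓝 (Real.circleAverage (fun ξ => h !₂[z + ξ * ρ, w] *
        (complexNormal Ω w (z + ξ * ρ) * (ζ + ξ * ρ * b)).re ^ τ) 0 1)) := by
    simp only [Real.circleAverage_def]
    refine Tendsto.const_smul ?_ _
    have hn1 : ∀ θ : ℝ, ‖circleMap 0 1 θ‖ ≤ 1 := fun θ => by simp
    -- The dominating constant comes from |δ(z, w + εζ)| / ε ≤ ‖ζ‖, valid because `(z, w)` is a
    -- boundary point.
    refine intervalIntegral.tendsto_integral_filter_of_dominated_convergence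
      (fun _ => H * (‖ζ‖ + |ρ| * ‖b‖) ^ τ) ?_ ?_ intervalIntegrable_const ?_
    · filter_upwards [hsub] with ε hε
      exact hε.1.aestronglyMeasurable_restrict_uIoc
    · filter_upwards [nhdsWithin_le_nhds hev, self_mem_nhdsWithin] with ε hε hε0
      refine Eventually.of_forall fun θ _ => ?_
      have hε0 : 0 < ε := hε0
      have h1 := hε _ (by simp : circleMap 0 1 θ ∈ Metric.closedBall (0 : ℂ) 1)
      have h2 := abs_signedBoundaryDist_blowup_le (ζ := ζ + circleMap 0 1 θ * ρ * b)
        (hfr _ (hn1 θ)) hε0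
      have h3 : ‖ζ + circleMap 0 1 θ * ρ * b‖ ≤ ‖ζ‖ + |ρ| * ‖b‖ := by
        refine (norm_add_le _ _).trans ?_
        simp
      simp only [hF]
      rw [norm_mul, Real.norm_eq_abs, Real.norm_eq_abs]
      refine mul_le_mul h1.1.2.le ?_ (abs_nonneg _) ((abs_nonneg _).trans h1.1.2.le)
      exact (Real.abs_rpow_le_abs_rpow _ _).trans
        (Real.rpow_le_rpow (abs_nonneg _) (h2.trans h3) hτ.le)
    · exact Eventually.of_forall fun θ _ => hlim _ (hn1 θ)
  have hfinal := le_of_tendsto_of_tendsto (hlim 0 (by simp)) havg (hsub.mono fun _ h => h.2)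
  rw [Real.circleAverage_eq_circleAverage_zero_one]
  simp only [zero_mul, add_zero] at hfinal
  refine hfinal.trans_eq ?_
  congr 1
  funext ξ
  simp only [add_zero]
  rw [mul_comm ξ]

/-! ### Rotation invariance -/

/-- The rotation `(z, w) ↦ (e^{iθ} z, w)` as a linear isometry. -/
noncomputable def rotateFirst (θ : ℝ) : C2 ≃ₗᵢ[ℝ] C2 :=
  LinearIsometryEquiv.piLpCongrRight 2 fun i : Fin 2 =>
    if i = 0 then rotation (Circle.exp θ) else LinearIsometryEquiv.refl ℝ ℂ

theorem rotateFirst_vec2 (θ : ℝ) (z w : ℂ) :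
    rotateFirst θ !₂[z, w] = !₂[Complex.exp (θ * Complex.I) * z, w] := by
  ext i; fin_cases i <;> simp [rotateFirst]

theorem vec2_eta (p : C2) : p = !₂[p 0, p 1] := by
  ext i; fin_cases i <;> simp

theorem IsHartogsDomain.rotateFirst_mem_iff {Ω : Set C2} (hΩ : IsHartogsDomain Ω) (θ : ℝ)
    (p : C2) : rotateFirst θ p ∈ Ω ↔ p ∈ Ω := by
  rw [vec2_eta p, rotateFirst_vec2]
  refine ⟨fun hp => ?_, hΩ.rotation θ _ _⟩
  have := hΩ.rotation (-θ) _ _ hp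
  rwa [← mul_assoc, ← Complex.exp_add, Complex.ofReal_neg, neg_mul, neg_add_cancel,
    Complex.exp_zero, one_mul] at this

theorem IsHartogsDomain.signedBoundaryDist_rotateFirst {Ω : Set C2} (hΩ : IsHartogsDomain Ω)
    (θ : ℝ) (p : C2) :
    signedBoundaryDist Ω (rotateFirst θ p) = signedBoundaryDist Ω p := by
  have himg : rotateFirst θ '' Ω = Ω := by
    ext q
    rw [(rotateFirst θ).image_eq_preimage_symm, Set.mem_preimage, ← hΩ.rotateFirst_mem_iff θ,
      LinearIsometryEquiv.apply_symm_apply]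
  have hfr : rotateFirst θ '' frontier Ω = frontier Ω := by
    have := (rotateFirst θ).toHomeomorph.image_frontier Ω
    rw [LinearIsometryEquiv.coe_toHomeomorph, himg] at this
    exact this
  have hinf : Metric.infDist (rotateFirst θ p) (frontier Ω) = Metric.infDist p (frontier Ω) := by
    conv_lhs => rw [← hfr]
    exact Metric.infDist_image (rotateFirst θ).isometry
  by_cases hp : p ∈ Ω
  · rw [signedBoundaryDist_of_mem hp,
      signedBoundaryDist_of_mem ((hΩ.rotateFirst_mem_iff θ p).2 hp), hinf]
  · rw [signedBoundaryDist_of_notMem hp,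
      signedBoundaryDist_of_notMem (mt (hΩ.rotateFirst_mem_iff θ p).1 hp), hinf]

/-- The rotation preserves δ and fixes the `w`-direction; the chain rule does the rest. -/
theorem IsHartogsDomain.complexNormal_rotate {Ω : Set C2} (hΩ : IsHartogsDomain Ω) (θ : ℝ)
    (w z : ℂ) : complexNormal Ω w (Complex.exp (θ * Complex.I) * z) = complexNormal Ω w z := by
  have h1 : signedBoundaryDist Ω ∘ (rotateFirst θ) = signedBoundaryDist Ω :=
    funext fun p => hΩ.signedBoundaryDist_rotateFirst θ p
  have h2 : ∀ ζ : ℂ, fderiv ℝ (signedBoundaryDist Ω) !₂[z, w] (EuclideanSpace.single 1 ζ) =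
      fderiv ℝ (signedBoundaryDist Ω) !₂[Complex.exp (θ * Complex.I) * z, w]
        (EuclideanSpace.single 1 ζ) := by
    intro ζ
    have h3 := (rotateFirst θ).toContinuousLinearEquiv.comp_right_fderiv
      (f := signedBoundaryDist Ω) (x := !₂[z, w])
    rw [LinearIsometryEquiv.coe_toContinuousLinearEquiv, h1, rotateFirst_vec2] at h3
    rw [h3]
    have h4 : rotateFirst θ (EuclideanSpace.single 1 ζ) = EuclideanSpace.single 1 ζ := by
      rw [single_one_eq_vec2, rotateFirst_vec2, mul_zero]
    change fderiv ℝ (signedBoundaryDist Ω) _ (rotateFirst θ (EuclideanSpace.single 1 ζ)) = _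
    rw [h4]
  simp only [complexNormal, h2]

theorem IsHartogsDomain.complexNormal_norm {Ω : Set C2} (hΩ : IsHartogsDomain Ω) (w z : ℂ) :
    complexNormal Ω w z = complexNormal Ω w (‖z‖ : ℂ) := by
  conv_lhs => rw [← Complex.norm_mul_exp_arg_mul_I z, mul_comm]
  exact hΩ.complexNormal_rotate _ _ _

/-! ### Regularity and phase of the complex normal -/

/-- Along the slice N = c/|c|, where `c` is built from the first derivatives of the smooth function
`r`. -/
theorem IsLocalDefining.contDiffAt_complexNormal {Ω V : Set C2} {r : C2 → ℝ} {w z : ℂ}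
    (h : IsLocalDefining Ω V r) (ho : IsOpen Ω) (hp : !₂[z, w] ∈ V)
    (hr : fderiv ℝ r !₂[z, w] ≠ 0) (hM : ∀ᶠ z' in 𝓝 z, !₂[z', w] ∈ frontier Ω) :
    ContDiffAt ℝ 2 (complexNormal Ω w) z := by
  set c : ℂ → ℂ := fun z' => (fderiv ℝ r !₂[z', w] (EuclideanSpace.single 1 1) : ℂ)
    - Complex.I * (fderiv ℝ r !₂[z', w] (EuclideanSpace.single 1 Complex.I) : ℂ) with hc
  have hslice : ContDiff ℝ 2 fun z' : ℂ => (!₂[z', w] : C2) := by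
    have : (fun z' : ℂ => (!₂[z', w] : C2)) = fun z' => EuclideanSpace.single (1 : Fin 2) w +
        (z'.re • EuclideanSpace.single (0 : Fin 2) 1 +
          z'.im • EuclideanSpace.single (0 : Fin 2) Complex.I) := by
      funext z'
      rw [← single_real_decomp, add_comm, ← vec2_eq_single_add]
    rw [this]
    exact contDiff_const.add ((Complex.reCLM.contDiff.smul contDiff_const).add
      (Complex.imCLM.contDiff.smul contDiff_const))
  have hDr : ContDiffAt ℝ 2 (fun z' => fderiv ℝ r !₂[z', w]) z :=
    ((h.contDiffAt_fderiv hp).of_le (WithTop.coe_le_coe.2 (le_top : (2 : ℕ∞) ≤ ⊤))).comp z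
      hslice.contDiffAt
  have hv : ∀ v : C2, ContDiffAt ℝ 2 (fun z' => ((fderiv ℝ r !₂[z', w] v : ℝ) : ℂ)) z := fun v =>
    Complex.ofRealCLM.contDiff.contDiffAt.comp z
      ((ContinuousLinearMap.apply ℝ ℝ v).contDiff.contDiffAt.comp z hDr)
  have hcd : ContDiffAt ℝ 2 c z := (hv _).sub (contDiffAt_const.mul (hv _))
  have hrel : ∀ᶠ z' in 𝓝 z, ‖complexNormal Ω w z'‖ = 1 ∧
      c z' = ‖fderiv ℝ r !₂[z', w]‖ * complexNormal Ω w z' ∧ fderiv ℝ r !₂[z', w] ≠ 0 := by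
    have hreg := (continuous_slice w).continuousAt.eventually (h.eventually_regular hp hr)
    filter_upwards [hM.eventually_nhds, hreg] with z' hz' hreg'
    have hE : ∀ v, fderiv ℝ r !₂[z', w] v =
        ‖fderiv ℝ r !₂[z', w]‖ * fderiv ℝ (signedBoundaryDist Ω) !₂[z', w] v := fun v => by
      conv_lhs => rw [h.fderiv_eq_smul ho hreg'.1 hz'.self_of_nhds hreg'.2]
      rfl
    refine ⟨h.norm_complexNormal ho hreg'.1 hreg'.2 hz', ?_, hreg'.2⟩
    simp only [hc, complexNormal]
    rw [hE, hE (EuclideanSpace.single 1 Complex.I), Complex.ofReal_mul, Complex.ofReal_mul]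
    ring
  have hcnorm : ∀ᶠ z' in 𝓝 z, c z' ≠ 0 ∧ ‖c z'‖⁻¹ • c z' = complexNormal Ω w z' := by
    filter_upwards [hrel] with z' hz'
    have hR : ‖c z'‖ = ‖fderiv ℝ r !₂[z', w]‖ := by
      rw [hz'.2.1, norm_mul, hz'.1, mul_one, Complex.norm_real, norm_norm]
    have hR0 : ‖fderiv ℝ r !₂[z', w]‖ ≠ 0 := norm_ne_zero_iff.2 hz'.2.2
    refine ⟨norm_ne_zero_iff.1 (by rw [hR]; exact hR0), ?_⟩
    rw [hR, hz'.2.1, Complex.real_smul, ← mul_assoc, ← Complex.ofReal_mul, inv_mul_cancel₀ hR0,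
      Complex.ofReal_one, one_mul]
  have hcz := hcnorm.self_of_nhds.1
  refine ContDiffAt.congr_of_eventuallyEq ?_ (hcnorm.mono fun z' hz' => hz'.2.symm)
  exact ((hcd.norm ℝ hcz).inv (norm_ne_zero_iff.2 hcz)).smul hcd

/-- A twice differentiable curve in the unit circle has a twice differentiable phase. -/
theorem exists_phase {α β : ℝ} (hαβ : α < β) {N : ℝ → ℂ} (hN : ContDiffOn ℝ 2 N (Set.Ioo α β))
    (hN1 : ∀ t ∈ Set.Ioo α β, ‖N t‖ = 1) :
    ∃ ψ : ℝ → ℝ, ContDiffOn ℝ 2 ψ (Set.Ioo α β) ∧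
      ∀ t ∈ Set.Ioo α β, N t = Complex.exp (ψ t * Complex.I) := by
  obtain ⟨t0, ht0⟩ := Set.nonempty_Ioo.2 hαβ
  have hd1 : ContDiffOn ℝ 1 (deriv N) (Set.Ioo α β) :=
    ((contDiffOn_succ_iff_deriv_of_isOpen (n := 1) isOpen_Ioo).1 hN).2.2
  have hNd : ∀ t ∈ Set.Ioo α β, HasDerivAt N (deriv N t) t := fun t ht =>
    ((hN.contDiffAt (isOpen_Ioo.mem_nhds ht)).differentiableAt (by simp)).hasDerivAt
  -- If N = e^{iψ}, then N̄ N' = iψ', so `g` is the only candidate for the derivative of the phase.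
  set g : ℝ → ℝ := fun t => (starRingEnd ℂ (N t) * deriv N t).im with hg
  have hgc : ContDiffOn ℝ 1 g (Set.Ioo α β) :=
    Complex.imCLM.contDiff.comp_contDiffOn
      ((Complex.conjCLE.contDiff.comp_contDiffOn (hN.of_le (by norm_num))).mul hd1)
  have hNN : ∀ t ∈ Set.Ioo α β, N t * starRingEnd ℂ (N t) = 1 := fun t ht => by
    rw [Complex.mul_conj, Complex.normSq_eq_norm_sq, hN1 t ht]; simp
  have hderivN : ∀ t ∈ Set.Ioo α β, deriv N t = g t * Complex.I * N t := by
    intro t ht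
    have h1 := (hNd t ht).mul ((Complex.conjCLE : ℂ →L[ℝ] ℂ).hasFDerivAt.comp_hasDerivAt t (hNd t ht))
    have h2 : HasDerivAt (fun _ : ℝ => (1 : ℂ)) 0 t := hasDerivAt_const t 1
    have h3 := h1.unique (h2.congr_of_eventuallyEq (by
      filter_upwards [isOpen_Ioo.mem_nhds ht] with x hx
      exact hNN x hx))
    have h4 : (starRingEnd ℂ (N t) * deriv N t).re = 0 := by
      have h5 := congrArg Complex.re h3
      simp at h5
      simp
      linarith
    have h6 : starRingEnd ℂ (N t) * deriv N t = g t * Complex.I := by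
      apply Complex.ext
      · rw [h4]; simp
      · simp [hg]
    rw [← h6]
    linear_combination (-deriv N t) * hNN t ht
  set ψ : ℝ → ℝ := fun t => Complex.arg (N t0) + ∫ x in t0..t, g x with hψ
  have hψd : ∀ t ∈ Set.Ioo α β, HasDerivAt ψ (g t) t := by
    intro t ht
    refine HasDerivAt.const_add _ (intervalIntegral.integral_hasDerivAt_right ?_ ?_ ?_)
    · refine (hgc.continuousOn.mono ?_).intervalIntegrable
      exact Set.OrdConnected.uIcc_subset Set.ordConnected_Ioo ht0 ht
    · exact hgc.continuousOn.stronglyMeasurableAtFilter isOpen_Ioo t ht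
    · exact hgc.continuousOn.continuousAt (isOpen_Ioo.mem_nhds ht)
  refine ⟨ψ, ?_, ?_⟩
  · refine (contDiffOn_succ_iff_deriv_of_isOpen (n := 1) isOpen_Ioo).2 ⟨fun t ht =>
      (hψd t ht).differentiableAt.differentiableWithinAt, by simp, ?_⟩
    exact hgc.congr fun t ht => (hψd t ht).deriv
  · set E : ℝ → ℂ := fun t => N t * Complex.exp (-(ψ t * Complex.I)) with hE
    have hEd : ∀ t ∈ Set.Ioo α β, HasDerivAt E 0 t := by
      intro t ht
      have h1 := (hNd t ht).mul (((hψd t ht).ofReal_comp.mul_const Complex.I).neg.cexp)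
      refine h1.congr_deriv ?_
      rw [hderivN t ht]
      ring
    have hconst : ∀ t ∈ Set.Ioo α β, E t = E t0 := fun t ht =>
      isOpen_Ioo.is_const_of_deriv_eq_zero isPreconnected_Ioo
        (fun x hx => (hEd x hx).differentiableAt.differentiableWithinAt)
        (fun x hx => (hEd x hx).deriv) ht ht0
    have hE0 : E t0 = 1 := by
      have h1 : N t0 = Complex.exp (Complex.arg (N t0) * Complex.I) := by
        conv_lhs => rw [← Complex.norm_mul_exp_arg_mul_I (N t0), hN1 t0 ht0]
        simp
      have h2 : ψ t0 = Complex.arg (N t0) := by simp [hψ]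
      simp only [hE]
      rw [h2]
      nth_rw 1 [h1]
      rw [← Complex.exp_add, add_neg_cancel, Complex.exp_zero]
    intro t ht
    have h1 := hconst t ht
    rw [hE0] at h1
    simp only [hE] at h1
    rw [Complex.exp_neg] at h1
    exact eq_of_mul_inv_eq_one h1

/-! ### Radial functions -/

theorem contDiffAt_radial {ψ : ℝ → ℝ} {z : ℂ} (hz : z ≠ 0)
    (hψ : ContDiffAt ℝ 2 ψ (Real.log ‖z‖)) : ContDiffAt ℝ 2 (fun z => ψ (Real.log ‖z‖)) z :=
  hψ.comp z ((contDiffAt_norm ℝ hz).log (norm_ne_zero_iff.2 hz))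

/-- Moving from z in the direction z changes log|z| at unit speed. -/
theorem fderiv_radial_self {ψ : ℝ → ℝ} {z : ℂ} (hz : z ≠ 0)
    (hψ : ContDiffAt ℝ 2 ψ (Real.log ‖z‖)) :
    fderiv ℝ (fun z : ℂ => ψ (Real.log ‖z‖)) z z = deriv ψ (Real.log ‖z‖) := by
  have h1 := ((contDiffAt_radial hz hψ).differentiableAt (by simp)).hasFDerivAt.hasDerivAt_line_zero
    (v := z)
  have h2 : HasDerivAt (fun x : ℝ => Real.log (1 + x) + Real.log ‖z‖) 1 0 := by
    have := (((hasDerivAt_id (0 : ℝ)).const_add 1).log (by simp)).add_const (Real.log ‖z‖)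
    simpa using this
  have h3 : HasDerivAt ψ (deriv ψ (Real.log ‖z‖)) (Real.log (1 + 0) + Real.log ‖z‖) := by
    simpa using (hψ.differentiableAt (by simp)).hasDerivAt
  have h4 := h3.comp (0 : ℝ) h2
  rw [mul_one] at h4
  refine h1.unique (h4.congr_of_eventuallyEq ?_)
  filter_upwards [eventually_gt_nhds (show (-1 : ℝ) < 0 by norm_num)] with x hx
  have hx1 : 0 < 1 + x := by linarith
  have h5 : z + x • z = ((1 + x : ℝ) : ℂ) * z := by rw [Complex.real_smul]; push_cast; ring
  rw [Function.comp_apply, h5, norm_mul, Complex.norm_real, Real.norm_eq_abs, abs_of_pos hx1,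
    Real.log_mul hx1.ne' (norm_ne_zero_iff.2 hz)]

/-- Conjugation makes the function even along the vertical line through a real point. -/
theorem fderiv_radial_I {ψ : ℝ → ℝ} {x : ℝ} (hx : 0 < x)
    (hψ : ContDiffAt ℝ 2 ψ (Real.log ‖(x : ℂ)‖)) :
    fderiv ℝ (fun z : ℂ => ψ (Real.log ‖z‖)) (x : ℂ) Complex.I = 0 := by
  have hx0 : (x : ℂ) ≠ 0 := by exact_mod_cast hx.ne'
  have h1 := ((contDiffAt_radial hx0 hψ).differentiableAt
    (by simp)).hasFDerivAt.hasDerivAt_line_zero (v := Complex.I)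
  have h1' : HasDerivAt (fun t : ℝ => ψ (Real.log ‖(x : ℂ) + t • Complex.I‖))
      (fderiv ℝ (fun z : ℂ => ψ (Real.log ‖z‖)) (x : ℂ) Complex.I) (-0) := by rwa [neg_zero]
  have h2 : HasDerivAt (fun t : ℝ => ψ (Real.log ‖(x : ℂ) + (-t) • Complex.I‖)) _ 0 :=
    h1'.comp (0 : ℝ) (hasDerivAt_neg (0 : ℝ))
  have h3 : (fun t : ℝ => ψ (Real.log ‖(x : ℂ) + (-t) • Complex.I‖)) =
      fun t : ℝ => ψ (Real.log ‖(x : ℂ) + t • Complex.I‖) := by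
    funext t
    congr 2
    have : (x : ℂ) + (-t) • Complex.I = starRingEnd ℂ ((x : ℂ) + t • Complex.I) := by
      simp [Complex.real_smul]
    rw [this, RCLike.norm_conj]
  rw [h3] at h2
  have := h1.unique h2
  linarith

/-! ### The variation of the phase -/

/-- Along a horizontal annulus in the boundary on which the complex normal is `e^{iψ(log|z|)}`
with `ψ` strictly monotone, plurisubharmonicity of `h δ^τ` outside bounds the variation of `ψ`. -/
theorem phase_variation_le {Ω : Set C2} (ho : IsOpen Ω) (hbd : HasSmoothBoundary Ω) {w : ℂ}
    {U : Set C2} (hU : IsOpen U) (hΩU : closure Ω ⊆ U) {h : C2 → ℝ} (hh : ContinuousOn h U)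
    (hpos : ∀ p ∈ U, 0 < h p) {τ : ℝ} (hτ : 1 < τ)
    (hpsh : PlurisubharmonicOn (fun p => h p * signedBoundaryDist Ω p ^ τ) (U \ closure Ω))
    {α β : ℝ} (hM : ∀ z : ℂ, z ≠ 0 → Real.log ‖z‖ ∈ Set.Ioo α β → !₂[z, w] ∈ frontier Ω)
    {ψ : ℝ → ℝ} (hψ : ContDiffOn ℝ 2 ψ (Set.Ioo α β))
    (hψ' : ∀ t ∈ Set.Ioo α β, deriv ψ t ≠ 0)
    (hN : ∀ z : ℂ, z ≠ 0 → Real.log ‖z‖ ∈ Set.Ioo α β →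
      complexNormal Ω w z = Complex.exp (ψ (Real.log ‖z‖) * Complex.I))
    {σ : ℝ} (hmono : StrictMonoOn (fun t => σ * ψ t) (Set.Ioo α β)) {t1 t2 : ℝ}
    (ht1 : t1 ∈ Set.Ioo α β) (ht2 : t2 ∈ Set.Ioo α β) (ht : t1 < t2) :
    |ψ t2 - ψ t1| ≤ Real.pi * (τ - 1) / τ := by
  by_contra! hlt
  have hτ0 : 0 < τ := by linarith
  have hτ1 : 0 < τ - 1 := by linarith
  obtain ⟨Δ, hΔ⟩ : ∃ Δ, Δ = ψ t2 - ψ t1 := ⟨_, rfl⟩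
  -- This `κ` stretches the phase variation to exactly π; a variation above π(τ-1)/τ means |κ| <
  -- τ/(τ-1).
  obtain ⟨κ, hκ⟩ : ∃ κ, κ = Real.pi / Δ := ⟨_, rfl⟩
  rw [← hΔ] at hlt
  have hΔ0 : 0 < |Δ| := lt_of_le_of_lt (by positivity) hlt
  have hΔne : Δ ≠ 0 := abs_pos.1 hΔ0
  have hκ2 : κ ^ 2 < (τ / (τ - 1)) ^ 2 := by
    rw [sq_lt_sq, hκ, abs_div, abs_of_pos Real.pi_pos, abs_of_pos (by positivity : 0 < τ / (τ - 1)),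
      div_lt_div_iff₀ hΔ0 hτ1]
    rwa [div_lt_iff₀ hτ0, mul_comm |Δ|] at hlt
  -- the rescaled phase runs from `0` to `π`
  set u : ℝ → ℝ := fun t => κ * (ψ t - ψ t1) with hu
  have hu1 : u t1 = 0 := by simp [hu]
  have hu2 : u t2 = Real.pi := by
    simp only [hu]; rw [← hΔ, hκ]; field_simp
  have hsub : Set.Icc t1 t2 ⊆ Set.Ioo α β := Set.Icc_subset_Ioo ht1.1 ht2.2
  have hu_mem : ∀ t ∈ Set.Ioo t1 t2, u t ∈ Set.Ioo 0 Real.pi := by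
    intro t hmem
    have hmt := hsub (Set.Ioo_subset_Icc_self hmem)
    have h1 : σ * ψ t1 < σ * ψ t := hmono ht1 hmt hmem.1
    have h2 : σ * ψ t < σ * ψ t2 := hmono hmt ht2 hmem.2
    have h3 : 0 < σ * Δ := by rw [hΔ]; linarith
    have h4 : u t = Real.pi * ((σ * ψ t - σ * ψ t1) / (σ * Δ)) := by
      have hσ : σ ≠ 0 := left_ne_zero_of_mul h3.ne'
      simp only [hu]; rw [hκ]; field_simp
    rw [h4]
    constructor
    · have : 0 < σ * ψ t - σ * ψ t1 := by linarith
      have := Real.pi_pos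
      positivity
    · have : (σ * ψ t - σ * ψ t1) / (σ * Δ) < 1 := by
        rw [div_lt_one h3, hΔ]; linarith
      have := mul_lt_mul_of_pos_left this Real.pi_pos
      linarith
  -- the maximum point of the touching function
  set X : Set ℂ := {z | ‖z‖ ∈ Set.Icc (Real.exp t1) (Real.exp t2)} with hX
  have hX0 : ∀ z ∈ X, z ≠ 0 := fun z hz h0 => by
    have := hz.1
    rw [h0, norm_zero] at this
    exact absurd this (not_le.2 (Real.exp_pos _))
  have hXlog : ∀ z ∈ X, Real.log ‖z‖ ∈ Set.Icc t1 t2 := fun z hz => by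
    have hz0 := norm_pos_iff.2 (hX0 z hz)
    exact ⟨(Real.le_log_iff_exp_le hz0).2 hz.1, (Real.log_le_iff_le_exp hz0).2 hz.2⟩
  have hXc : IsCompact X := by
    refine (isCompact_closedBall (0 : ℂ) (Real.exp t2)).of_isClosed_subset
      (isClosed_Icc.preimage continuous_norm) fun z hz => ?_
    rw [mem_closedBall_zero_iff]; exact hz.2
  have hexp : ∀ t ∈ Set.Icc t1 t2, ((Real.exp t : ℝ) : ℂ) ∈ X := fun t ht => by
    simp only [hX, Set.mem_ofPred_eq, Complex.norm_real, Real.norm_eq_abs, Real.abs_exp]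
    exact ⟨Real.exp_le_exp.2 ht.1, Real.exp_le_exp.2 ht.2⟩
  have hXU : ∀ z ∈ X, !₂[z, w] ∈ U := fun z hz =>
    hΩU (frontier_subset_closure (hM z (hX0 z hz) (hsub (hXlog z hz))))
  have hψc : ∀ z : ℂ, z ≠ 0 → Real.log ‖z‖ ∈ Set.Ioo α β →
      ContDiffAt ℝ 2 ψ (Real.log ‖z‖) := fun z _ hz => hψ.contDiffAt (isOpen_Ioo.mem_nhds hz)
  -- Since τ > 1, `F` vanishes on both bounding circles, so its maximum `lam` is attained inside.
  -- Then h ≤ lam sin(u)^(1-τ), with equality at the maximum point, and the sub-mean value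
  -- inequality passes to the comparison function without differentiating `h`.
  set F : ℂ → ℝ := fun z => h !₂[z, w] * Real.sin (u (Real.log ‖z‖)) ^ (τ - 1) with hF
  have hFc : ContinuousOn F X := by
    refine ContinuousOn.mul (hh.comp (continuous_slice w).continuousOn hXU) ?_
    refine ContinuousOn.rpow_const (fun z hz => ?_) fun z _ => Or.inr hτ1.le
    have h1 := (contDiffAt_radial (hX0 z hz) (hψc z (hX0 z hz) (hsub (hXlog z hz)))).continuousAt
    have h2 : ContinuousAt (fun z : ℂ => κ * (ψ (Real.log ‖z‖) - ψ t1)) z :=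
      continuousAt_const.mul (h1.sub continuousAt_const)
    exact (Real.continuous_sin.continuousAt.comp h2).continuousWithinAt
  obtain ⟨z, hzX, hzmax⟩ := hXc.exists_isMaxOn ⟨_, hexp t1 ⟨le_rfl, ht.le⟩⟩ hFc
  set lam := F z with hlam
  have hlam0 : 0 < lam := by
    have hm : (t1 + t2) / 2 ∈ Set.Ioo t1 t2 := ⟨by linarith, by linarith⟩
    have hmX := hexp _ (Set.Ioo_subset_Icc_self hm)
    refine lt_of_lt_of_le ?_ (hzmax hmX)
    have h1 := hu_mem _ hm
    have h2 := hpos _ (hXU _ hmX)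
    have h3 : Real.log ‖((Real.exp ((t1 + t2) / 2) : ℝ) : ℂ)‖ = (t1 + t2) / 2 := by
      rw [Complex.norm_real, Real.norm_eq_abs, Real.abs_exp, Real.log_exp]
    simp only [hF]
    rw [h3]
    exact mul_pos h2 (Real.rpow_pos_of_pos (Real.sin_pos_of_mem_Ioo h1) _)
  have hz0 := hX0 z hzX
  have hzlog : Real.log ‖z‖ ∈ Set.Ioo t1 t2 := by
    have h1 := hXlog z hzX
    refine ⟨lt_of_le_of_ne h1.1 fun he => ?_, lt_of_le_of_ne h1.2 fun he => ?_⟩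
    · have : lam = 0 := by
        simp only [hlam, hF]
        rw [← he, hu1, Real.sin_zero, Real.zero_rpow hτ1.ne', mul_zero]
      exact hlam0.ne' this
    · have : lam = 0 := by
        simp only [hlam, hF]
        rw [he, hu2, Real.sin_pi, Real.zero_rpow hτ1.ne', mul_zero]
      exact hlam0.ne' this
  -- the comparison function
  set φ : ℂ → ℝ := fun z => ψ (Real.log ‖z‖) with hφ
  have hzI := hsub (Set.Ioo_subset_Icc_self hzlog)
  have hφz : ContDiffAt ℝ 2 φ z := contDiffAt_radial hz0 (hψc z hz0 hzI)
  have hgrad : fderiv ℝ φ z 1 ≠ 0 ∨ fderiv ℝ φ z Complex.I ≠ 0 := by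
    by_contra! hno
    have h1 := fderiv_radial_self hz0 (hψc z hz0 hzI)
    have h2 : z = z.re • (1 : ℂ) + z.im • Complex.I := by
      simp [Complex.re_add_im]
    rw [← hφ] at h1
    apply hψ' _ hzI
    rw [← h1]
    conv_lhs => rw [h2, map_add, map_smul, map_smul]
    rw [← h2, hno.1, hno.2]
    simp
  obtain ⟨ζ, b, hζ, hG⟩ := exists_not_submean_comparison hφz hgrad hτ hκ2 (k := ψ t1)
    (Real.sin_pos_of_mem_Ioo (hu_mem _ hzlog))
  obtain ⟨G, hGdef⟩ : ∃ G : ℂ → ℝ, G = fun ξ => Real.sin (κ * (φ (z + ξ) - ψ t1)) ^ (1 - τ) *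
        (Complex.exp (φ (z + ξ) * Complex.I) * (ζ + ξ * b)).re ^ τ := ⟨_, rfl⟩
  refine hG G hGdef ?_
  -- good behaviour near the maximum point
  have hopen : ∀ᶠ y in 𝓝 z, Real.log ‖y‖ ∈ Set.Ioo t1 t2 ∧ y ≠ 0 :=
    (((continuous_norm.continuousAt.log (norm_ne_zero_iff.2 hz0)).eventually
      (isOpen_Ioo.mem_nhds hzlog))).and (eventually_ne_nhds hz0)
  have hshift : Tendsto (fun ξ : ℂ => z + ξ) (𝓝 0) (𝓝 z) := by
    have : Continuous fun ξ : ℂ => z + ξ := by fun_prop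
    simpa using this.tendsto 0
  have hqc : ∀ ξ : ℂ, ContinuousAt φ (z + ξ) → ContinuousAt (fun ξ : ℂ =>
      (Complex.exp (φ (z + ξ) * Complex.I) * (ζ + ξ * b)).re) ξ := fun ξ hc => by
    have h1 : ContinuousAt (fun ξ => (φ (z + ξ) : ℂ)) ξ :=
      Complex.continuous_ofReal.continuousAt.comp
        (ContinuousAt.comp (f := fun ξ : ℂ => z + ξ) hc (by fun_prop))
    exact Complex.continuous_re.continuousAt.comp
      ((h1.mul continuousAt_const).cexp.mul (by fun_prop))
  have hq : ∀ᶠ ξ in 𝓝 (0 : ℂ), 0 < (Complex.exp (φ (z + ξ) * Complex.I) * (ζ + ξ * b)).re :=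
    (hqc 0 (by rw [add_zero]; exact hφz.continuousAt)).eventually
      (eventually_gt_nhds (by simp only [add_zero, zero_mul]; rw [hζ]; exact one_pos))
  obtain ⟨δ, hδ, hball⟩ := Metric.eventually_nhds_iff.1 ((hshift.eventually hopen).and hq)
  have hsm : ∀ᶠ ρ in 𝓝[>] (0 : ℝ), ρ < δ := nhdsWithin_le_nhds (eventually_lt_nhds hδ)
  filter_upwards [hsm, self_mem_nhdsWithin] with ρ hρδ hρ0
  have hρ0 : 0 < ρ := hρ0
  have hloc : ∀ ξ : ℂ, ‖ξ‖ ≤ ρ → (Real.log ‖z + ξ‖ ∈ Set.Ioo t1 t2 ∧ z + ξ ≠ 0) ∧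
      0 < (Complex.exp (φ (z + ξ) * Complex.I) * (ζ + ξ * b)).re := fun ξ hξ =>
    hball (by rw [dist_zero_right]; linarith)
  have hIoo : ∀ {t}, t ∈ Set.Ioo t1 t2 → t ∈ Set.Ioo α β := fun ht =>
    hsub (Set.Ioo_subset_Icc_self ht)
  have hscale : ∀ ξ : ℂ, ‖ξ‖ ≤ 1 → ‖ξ * ρ‖ ≤ ρ := fun ξ hξ => by
    rw [norm_mul, Complex.norm_real, Real.norm_eq_abs, abs_of_pos hρ0]
    exact mul_le_of_le_one_left hρ0.le hξ
  have hsubm := submean_blowup ho hbd (z := z) (ζ := ζ) (b := b) hU hΩU hh hτ0 hpsh (ρ := ρ)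
    (fun ξ hξ => by
      have h1 := (hloc _ (hscale ξ hξ)).1
      filter_upwards [(continuous_norm.continuousAt.log (norm_ne_zero_iff.2 h1.2)).eventually
        (isOpen_Ioo.mem_nhds h1.1), eventually_ne_nhds h1.2] with y hy hy0
      exact hM y hy0 (hIoo hy))
    (fun ξ hξ => by
      have h1 := hloc _ (hscale ξ hξ)
      rw [hN _ h1.1.2 (hIoo h1.1.1)]
      exact h1.2)
  have hsph : ∀ ξ ∈ Metric.sphere (0 : ℂ) |ρ|, ‖ξ‖ ≤ ρ := fun ξ hξ => by
    rw [mem_sphere_zero_iff_norm, abs_of_pos hρ0] at hξ; exact hξ.le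
  have hφat : ∀ ξ : ℂ, ‖ξ‖ ≤ ρ → ContinuousAt φ (z + ξ) := fun ξ hξ =>
    (contDiffAt_radial (hloc ξ hξ).1.2
      (hψc _ (hloc ξ hξ).1.2 (hIoo (hloc ξ hξ).1.1))).continuousAt
  have hmemX : ∀ ξ : ℂ, ‖ξ‖ ≤ ρ → z + ξ ∈ X := fun ξ hξ => by
    have h1 := (hloc ξ hξ).1
    have h2 := norm_pos_iff.2 h1.2
    exact ⟨(Real.le_log_iff_exp_le h2).1 h1.1.1.le, (Real.log_le_iff_le_exp h2).1 h1.1.2.le⟩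
  have hGint : CircleIntegrable (fun ξ => lam • G ξ) 0 ρ := by
    apply ContinuousOn.circleIntegrable'
    intro ξ hξ
    have hξ' := hsph ξ hξ
    have hc := hφat ξ hξ'
    have h1 : ContinuousAt (fun ξ => φ (z + ξ)) ξ :=
      ContinuousAt.comp (f := fun ξ : ℂ => z + ξ) hc (by fun_prop)
    have h2 : ContinuousAt (fun ξ : ℂ => κ * (φ (z + ξ) - ψ t1)) ξ :=
      continuousAt_const.mul (h1.sub continuousAt_const)
    have h3 : ContinuousAt (fun ξ => Real.sin (κ * (φ (z + ξ) - ψ t1)) ^ (1 - τ)) ξ :=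
      ContinuousAt.rpow_const (Real.continuous_sin.continuousAt.comp h2)
        (Or.inl (Real.sin_pos_of_mem_Ioo (hu_mem _ (hloc ξ hξ').1.1)).ne')
    have h4 : ContinuousAt G ξ := by
      rw [hGdef]; exact h3.mul ((hqc ξ hc).rpow_const (Or.inr hτ0.le))
    exact (h4.const_smul lam).continuousWithinAt
  have hLint : CircleIntegrable (fun ξ => h !₂[z + ξ, w] *
      (complexNormal Ω w (z + ξ) * (ζ + ξ * b)).re ^ τ) 0 ρ := by
    apply ContinuousOn.circleIntegrable'
    have hcont : ContinuousOn (fun ξ => h !₂[z + ξ, w] *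
        (Complex.exp (φ (z + ξ) * Complex.I) * (ζ + ξ * b)).re ^ τ) (Metric.sphere 0 |ρ|) := by
      intro ξ hξ
      have hξ' := hsph ξ hξ
      refine ContinuousAt.continuousWithinAt (ContinuousAt.mul ?_ ?_)
      · have h1 := hh.continuousAt (hU.mem_nhds (hXU _ (hmemX ξ hξ')))
        exact ContinuousAt.comp (f := fun ξ : ℂ => (!₂[z + ξ, w] : C2)) h1
          ((continuous_slice w).comp (continuous_const.add continuous_id)).continuousAt
      · exact (hqc ξ (hφat ξ hξ')).rpow_const (Or.inr hτ0.le)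
    refine hcont.congr fun ξ hξ => ?_
    have h1 := (hloc ξ (hsph ξ hξ)).1
    simp only [hN _ h1.2 (hIoo h1.1), hφ]
  have hle := Real.circleAverage_mono hLint hGint (fun ξ hξ => by
    have hξ' := hsph ξ hξ
    obtain ⟨h1, h2⟩ := hloc ξ hξ'
    have h3 := Real.sin_pos_of_mem_Ioo (hu_mem _ h1.1)
    have h4 : h !₂[z + ξ, w] * Real.sin (u (Real.log ‖z + ξ‖)) ^ (τ - 1) ≤ lam :=
      hzmax (hmemX ξ hξ')
    have h5 : h !₂[z + ξ, w] ≤ lam * Real.sin (u (Real.log ‖z + ξ‖)) ^ (1 - τ) := by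
      rw [← neg_sub τ 1, Real.rpow_neg h3.le, ← div_eq_mul_inv,
        le_div_iff₀ (Real.rpow_pos_of_pos h3 _)]
      exact h4
    rw [hN _ h1.2 (hIoo h1.1), hGdef, smul_eq_mul, ← mul_assoc]
    exact mul_le_mul_of_nonneg_right h5 (Real.rpow_nonneg h2.le _))
  have hfin := hsubm.trans hle
  rw [Real.circleAverage_fun_smul, smul_eq_mul, hN z hz0 hzI] at hfin
  have hzsin := Real.sin_pos_of_mem_Ioo (hu_mem _ hzlog)
  have hG0 : h !₂[z, w] * (Complex.exp (ψ (Real.log ‖z‖) * Complex.I) * ζ).re ^ τ =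
      lam * G 0 := by
    have h1 : lam * Real.sin (u (Real.log ‖z‖)) ^ (1 - τ) = h !₂[z, w] := by
      simp only [hlam, hF]
      rw [mul_assoc, ← Real.rpow_add hzsin]
      simp
    rw [hGdef]
    simp only [add_zero, zero_mul]
    rw [← mul_assoc]
    congr 1
    exact h1.symm
  rw [hG0] at hfin
  exact le_of_mul_le_mul_left hfin hlam0

/-! ### From the curvature bound to the estimates for C and τ -/

/-- At x = e^t the gradient of ψ(log|z|) is radial of size |ψ'(t)|/x, so the mixed derivative has
modulus |ψ'(t)|/(4x). -/
theorem abs_deriv_phase_gt {Ω : Set C2} (ho : IsOpen Ω) (hbd : HasSmoothBoundary Ω) {w : ℂ}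
    {α β C : ℝ} (hC : 0 < C)
    (hM : ∀ z : ℂ, z ≠ 0 → Real.log ‖z‖ ∈ Set.Ioo α β → !₂[z, w] ∈ frontier Ω)
    {ψ : ℝ → ℝ} (hψ : ContDiffOn ℝ 2 ψ (Set.Ioo α β))
    (hN : ∀ z : ℂ, z ≠ 0 → Real.log ‖z‖ ∈ Set.Ioo α β →
      complexNormal Ω w z = Complex.exp (ψ (Real.log ‖z‖) * Complex.I))
    {t : ℝ} (ht : t ∈ Set.Ioo α β)
    (hcurv : C / ‖((Real.exp t : ℝ) : ℂ)‖ < ‖dZ 1 (dZbar 0 (fun p => (signedBoundaryDist Ω p : ℂ)))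
      !₂[((Real.exp t : ℝ) : ℂ), w]‖) : 4 * C < |deriv ψ t| := by
  set x := Real.exp t with hx
  have hx0 : 0 < x := Real.exp_pos t
  have hz0 : (x : ℂ) ≠ 0 := by exact_mod_cast hx0.ne'
  have hnx : ‖(x : ℂ)‖ = x := by rw [Complex.norm_real, Real.norm_eq_abs, abs_of_pos hx0]
  have hlog : Real.log ‖(x : ℂ)‖ = t := by rw [hnx, hx, Real.log_exp]
  have hmem : Real.log ‖(x : ℂ)‖ ∈ Set.Ioo α β := by rwa [hlog]
  have hψt : ContDiffAt ℝ 2 ψ (Real.log ‖(x : ℂ)‖) := hψ.contDiffAt (isOpen_Ioo.mem_nhds hmem)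
  have hnear : ∀ᶠ z in 𝓝 (x : ℂ), z ≠ 0 ∧ Real.log ‖z‖ ∈ Set.Ioo α β :=
    (eventually_ne_nhds hz0).and
      ((continuous_norm.continuousAt.log (norm_ne_zero_iff.2 hz0)).eventually
        (isOpen_Ioo.mem_nhds hmem))
  -- If the first derivative were not differentiable here, the mixed derivative would be zero by
  -- convention, against the strict positive lower bound.
  have hfd : DifferentiableAt ℝ (dZbar 0 (fun p => (signedBoundaryDist Ω p : ℂ))) !₂[(x : ℂ), w] := by
    by_contra hno
    rw [dZ, fderiv_zero_of_not_differentiableAt hno] at hcurv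
    simp only [zero_apply, mul_zero, sub_zero, norm_zero] at hcurv
    exact absurd hcurv (not_lt.2 (by positivity))
  obtain ⟨V, r, hV, hp, hr, hm, hr0⟩ := hbd _ (hM _ hz0 hmem)
  have h1 := IsLocalDefining.norm_dZ_dZbar ⟨hV, hr, hm⟩ ho hp hr0
    (hnear.mono fun z hz => hM z hz.1 hz.2) (φ := fun z => ψ (Real.log ‖z‖))
    (hnear.mono fun z hz => hN z hz.1 hz.2)
    ((contDiffAt_radial hz0 hψt).differentiableAt (by simp)) hfd
  have h2 := fderiv_radial_self hz0 hψt
  have h3 : (x : ℂ) = x • (1 : ℂ) := by simp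
  have h4 : x * fderiv ℝ (fun z : ℂ => ψ (Real.log ‖z‖)) x 1 = deriv ψ t := by
    rw [hlog] at h2
    rw [← h2]
    conv_rhs => rw [h3, map_smul, ← h3]
    rfl
  rw [fderiv_radial_I hx0 hψt, Complex.ofReal_zero, mul_zero, add_zero, Complex.norm_real,
    Real.norm_eq_abs] at h1
  rw [h1, hnx, div_lt_iff₀ hx0] at hcurv
  rw [← h4, abs_mul, abs_of_pos hx0]
  linarith

theorem mainTheorem6 (Ω : Set C2) (hΩ : IsHartogsDomain Ω) (hbd : HasSmoothBoundary Ω)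
    (w : ℂ) (A B C : ℝ) (hA : 0 < A) (hAB : A < B) (hC : 0 < C)
    (hM : ∀ z : ℂ, A ≤ ‖z‖ ^ 2 → ‖z‖ ^ 2 ≤ B → !₂[z, w] ∈ frontier Ω)
    (hcurv : ∀ z : ℂ, A ≤ ‖z‖ ^ 2 → ‖z‖ ^ 2 ≤ B →
      C / ‖z‖ < ‖dZ 1 (dZbar 0 (fun p => (signedBoundaryDist Ω p : ℂ))) !₂[z, w]‖)
    (U : Set C2) (hU : IsOpen U) (hΩU : closure Ω ⊆ U)
    (h : C2 → ℝ) (hsmooth : ContDiffOn ℝ ∞ h U) (hpos : ∀ p ∈ U, 0 < h p)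
    (τ : ℝ) (hτ : 1 < τ)
    (hpsh : PlurisubharmonicOn (fun p => h p * signedBoundaryDist Ω p ^ τ) (U \ closure Ω)) :
    C < Real.pi / (2 * Real.log (B / A)) ∧
      Real.pi / (Real.pi - 2 * C * Real.log (B / A)) < τ := by
  have ho := hΩ.isOpen
  have hB : 0 < B := hA.trans hAB
  -- The halves appear because the annulus is given by |z|². The open interval is used so that the
  -- slice stays in the boundary near each of its points.
  obtain ⟨α, hα⟩ : ∃ α, α = Real.log A / 2 := ⟨_, rfl⟩
  obtain ⟨β, hβ⟩ : ∃ β, β = Real.log B / 2 := ⟨_, rfl⟩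
  have hαβ : α < β := by
    have := Real.log_lt_log hA hAB
    rw [hα, hβ]; linarith
  have hann : ∀ z : ℂ, z ≠ 0 → Real.log ‖z‖ ∈ Set.Ioo α β → A ≤ ‖z‖ ^ 2 ∧ ‖z‖ ^ 2 ≤ B := by
    intro z hz hzl
    have hz2 : 0 < ‖z‖ ^ 2 := by positivity
    have h2 : Real.log (‖z‖ ^ 2) = 2 * Real.log ‖z‖ := by rw [Real.log_pow]; norm_num
    rw [hα, hβ] at hzl
    exact ⟨(Real.log_le_log_iff hA hz2).1 (by linarith [hzl.1]),
      (Real.log_le_log_iff hz2 hB).1 (by linarith [hzl.2])⟩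
  have hM' : ∀ z : ℂ, z ≠ 0 → Real.log ‖z‖ ∈ Set.Ioo α β → !₂[z, w] ∈ frontier Ω :=
    fun z hz hzl => hM z (hann z hz hzl).1 (hann z hz hzl).2
  have hnear : ∀ z : ℂ, z ≠ 0 → Real.log ‖z‖ ∈ Set.Ioo α β →
      ∀ᶠ z' in 𝓝 z, !₂[z', w] ∈ frontier Ω := fun z hz hzl => by
    filter_upwards [eventually_ne_nhds hz,
      (continuous_norm.continuousAt.log (norm_ne_zero_iff.2 hz)).eventually
        (isOpen_Ioo.mem_nhds hzl)] with z' h1 h2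
    exact hM' z' h1 h2
  -- the phase of the normal along the annulus
  have hexp0 : ∀ t : ℝ, ((Real.exp t : ℝ) : ℂ) ≠ 0 := fun t => by
    exact_mod_cast (Real.exp_pos t).ne'
  have hexplog : ∀ t : ℝ, Real.log ‖((Real.exp t : ℝ) : ℂ)‖ = t := fun t => by
    rw [Complex.norm_real, Real.norm_eq_abs, Real.abs_exp, Real.log_exp]
  obtain ⟨ψ, hψ, hψN⟩ := exists_phase (N := fun t => complexNormal Ω w ((Real.exp t : ℝ) : ℂ)) hαβ
    (fun t ht => by
      have hmem : Real.log ‖((Real.exp t : ℝ) : ℂ)‖ ∈ Set.Ioo α β := by rwa [hexplog]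
      obtain ⟨V, r, hV, hp, hr, hm, hr0⟩ := hbd _ (hM' _ (hexp0 t) hmem)
      have h1 := IsLocalDefining.contDiffAt_complexNormal ⟨hV, hr, hm⟩ ho hp hr0
        (hnear _ (hexp0 t) hmem)
      exact (h1.comp t (Complex.ofRealCLM.contDiff.contDiffAt.comp t
        Real.contDiff_exp.contDiffAt)).contDiffWithinAt)
    (fun t ht => by
      have hmem : Real.log ‖((Real.exp t : ℝ) : ℂ)‖ ∈ Set.Ioo α β := by rwa [hexplog]
      obtain ⟨V, r, hV, hp, hr, hm, hr0⟩ := hbd _ (hM' _ (hexp0 t) hmem)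
      exact IsLocalDefining.norm_complexNormal ⟨hV, hr, hm⟩ ho hp hr0 (hnear _ (hexp0 t) hmem))
  have hN : ∀ z : ℂ, z ≠ 0 → Real.log ‖z‖ ∈ Set.Ioo α β →
      complexNormal Ω w z = Complex.exp (ψ (Real.log ‖z‖) * Complex.I) := fun z hz hzl => by
    rw [← hψN _ hzl, Real.exp_log (norm_pos_iff.2 hz)]
    exact hΩ.complexNormal_norm w z
  have hψ' : ∀ t ∈ Set.Ioo α β, 4 * C < |deriv ψ t| := fun t ht => by
    have hmem : Real.log ‖((Real.exp t : ℝ) : ℂ)‖ ∈ Set.Ioo α β := by rwa [hexplog]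
    have h1 := hann _ (hexp0 t) hmem
    exact abs_deriv_phase_gt ho hbd hC hM' hψ hN ht (hcurv _ h1.1 h1.2)
  have hψne : ∀ t ∈ Set.Ioo α β, deriv ψ t ≠ 0 := fun t ht => by
    have := hψ' t ht
    exact abs_pos.1 (by linarith)
  have hψd : ∀ t ∈ Set.Ioo α β, HasDerivAt ψ (deriv ψ t) t := fun t ht =>
    ((hψ.contDiffAt (isOpen_Ioo.mem_nhds ht)).differentiableAt (by simp)).hasDerivAt
  -- By Darboux's theorem a nowhere vanishing derivative has constant sign.
  obtain ⟨σ, hσ, hσψ⟩ : ∃ σ : ℝ, |σ| = 1 ∧ ∀ t ∈ Set.Ioo α β, 4 * C < σ * deriv ψ t := by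
    rcases hasDerivWithinAt_forall_lt_or_forall_gt_of_forall_ne (convex_Ioo α β)
      (fun t ht => (hψd t ht).hasDerivWithinAt) hψne with hs | hs
    · refine ⟨-1, by simp, fun t ht => ?_⟩
      have := hψ' t ht
      rw [abs_of_neg (hs t ht)] at this
      linarith
    · refine ⟨1, by simp, fun t ht => ?_⟩
      have := hψ' t ht
      rw [abs_of_pos (hs t ht)] at this
      linarith
  -- The case `c = 0` gives the monotone phase; `c = 4 * C` gives the slack that makes the final
  -- inequality strict.
  have hmono : ∀ c : ℝ, c ≤ 4 * C → StrictMonoOn (fun t => σ * ψ t - c * t) (Set.Ioo α β) := by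
    intro c hc
    have hd : ∀ t ∈ Set.Ioo α β, HasDerivAt (fun t => σ * ψ t - c * t) (σ * deriv ψ t - c) t :=
      fun t ht =>
        (((hψd t ht).const_mul σ).sub ((hasDerivAt_id t).const_mul c)).congr_deriv (by simp)
    refine strictMonoOn_of_deriv_pos (convex_Ioo α β)
      (fun t ht => (hd t ht).continuousAt.continuousWithinAt) fun t ht => ?_
    rw [interior_Ioo] at ht
    rw [(hd t ht).deriv]
    linarith [hσψ t ht]
  have hvar : ∀ t1 ∈ Set.Ioo α β, ∀ t2 ∈ Set.Ioo α β, t1 < t2 →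
      σ * ψ t2 - σ * ψ t1 ≤ Real.pi * (τ - 1) / τ := by
    intro t1 h1 t2 h2 h12
    have hm : StrictMonoOn (fun t => σ * ψ t) (Set.Ioo α β) := by
      simpa using hmono 0 (by linarith)
    refine le_trans ?_ (phase_variation_le ho hbd hU hΩU hsmooth.continuousOn hpos hτ hpsh hM' hψ
      hψne hN hm h1 h2 h12)
    rw [← mul_sub]
    refine (le_abs_self _).trans_eq ?_
    rw [abs_mul, hσ, one_mul]
  -- let the subinterval exhaust the annulus
  have hstrict : 4 * C * (β - α) < Real.pi * (τ - 1) / τ := by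
    set ℓ := (β - α) / 3 with hℓ
    have hℓ0 : 0 < ℓ := by rw [hℓ]; linarith
    have hm := hmono (4 * C) le_rfl
    set g : ℝ → ℝ := fun t => σ * ψ t - 4 * C * t with hg
    have ha : α + ℓ ∈ Set.Ioo α β := ⟨by linarith, by linarith⟩
    have hb : β - ℓ ∈ Set.Ioo α β := ⟨by linarith, by linarith⟩
    have hη : g (α + ℓ) < g (β - ℓ) := hm ha hb (by linarith)
    obtain ⟨η, hηdef⟩ : ∃ η, η = g (β - ℓ) - g (α + ℓ) := ⟨_, rfl⟩
    have hη0 : 0 < η := by linarith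
    -- Trimming both ends by `ε` costs 8Cε ≤ η/2, less than the gain `η` of `σ ψ` over slope `4 * C`
    -- on the middle third, so the bound for closed subintervals becomes strict on the whole one.
    obtain ⟨ε, hε⟩ : ∃ ε, ε = min ℓ (η / (16 * C)) := ⟨_, rfl⟩
    have hε0 : 0 < ε := by rw [hε]; positivity
    have hεℓ : ε ≤ ℓ := hε ▸ min_le_left _ _
    have hεη : 16 * C * ε ≤ η := by
      have : ε ≤ η / (16 * C) := hε ▸ min_le_right _ _
      rw [le_div_iff₀ (by positivity)] at this
      linarith
    have ha' : α + ε ∈ Set.Ioo α β := ⟨by linarith, by linarith⟩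
    have hb' : β - ε ∈ Set.Ioo α β := ⟨by linarith, by linarith⟩
    have h1 : g (α + ε) ≤ g (α + ℓ) := hm.monotoneOn ha' ha (by linarith)
    have h2 : g (β - ℓ) ≤ g (β - ε) := hm.monotoneOn hb hb' (by linarith)
    have h3 := hvar _ ha' _ hb' (by linarith)
    simp only [hg] at h1 h2 hηdef
    linarith
  have hτ0 : 0 < τ := by linarith
  obtain ⟨ℒ, hℒ⟩ : ∃ ℒ, ℒ = Real.log (B / A) := ⟨_, rfl⟩
  have hlog : ℒ = 2 * (β - α) := by
    rw [hℒ, Real.log_div hB.ne' hA.ne', hα, hβ]; ring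
  have hℒ0 : 0 < ℒ := by rw [hlog]; linarith
  rw [← hℒ]
  have hmain : 2 * C * ℒ * τ < Real.pi * (τ - 1) := by
    rw [lt_div_iff₀ hτ0] at hstrict
    rw [hlog]; linarith
  have hlt : 2 * C * ℒ < Real.pi := by
    by_contra! hge
    have := mul_le_mul_of_nonneg_right hge hτ0.le
    linarith [Real.pi_pos]
  constructor
  · rw [lt_div_iff₀ (by positivity)]; linarith
  · rw [div_lt_iff₀ (by linarith)]; linarith
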